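/- All manifolds and maps are smooth ($C^\infty$), and $I=[0,1]$. A smooth isotopy of a manifold $N$ (possibly with boundary) is a family $(h_t)_{t\in I}$ of diffeomorphisms of $N$ such that $(t,p)\mapsto h_t(p)$ and $(t,p)\mapsto h_t^{-1}(p)$ are smooth on $I\times N$; then $h_0$ and $h_1$ are called isotopic. $\mathrm{Diff}(N)$ is the group of diffeomorphisms of $N$ and $\mathrm{Diff}(N\ \mathrm{rel}\ \partial)$ is the subgroup of those that are the identity in a neighborhood of $\partial N$. Two elements of $\mathrm{Diff}(N\ \mathrm{rel}\ \partial)$ are isotopic rel boundary if they are joined by a smooth isotopy in $\mathrm{Diff}(N\ \mathrm{rel}\ \partial)$ that is constantly the identity on a neighborhood of $\partial N$. $\pi_0\mathrm{Diff}(N)$ and $\pi_0\mathrm{Diff}(N\ \mathrm{rel}\ \partial)$ are the groups of isotopy classes, resp. of isotopy classes rel boundary. Lemma ("closing the clam"). Let $M$ be a closed (compact, without boundary, not necessarily connected or orientable) smooth manifold. For $g\in\mathrm{Diff}(M\times I\ \mathrm{rel}\ \partial)$ let $\overline g\in \mathrm{Diff}(M\times S^1)$ be the closure of $g$, that is, the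 diffeomorphism with $\overline g\circ q=q\circ g$, where $q:M\times I\to M\times S^1$, $q(x,s)=(x,e^{2\pi i s})$, identifies top and bottom. Then the homomorphism $$\pi_0\mathrm{Diff}(M\times I\ \mathrm{rel}\ \partial)\to\pi_0\mathrm{Diff}(M\times S^1),\qquad [g]\mapsto[\overline g],$$ is injective. Equivalently, if $g\in\mathrm{Diff}(M\times I\ \mathrm{rel}\ \partial)$ and $\overline g$ is isotopic to the identity of $M\times S^1$, then $g$ is isotopic to the identity of $M\times I$ rel boundary. -/

import Mathlib

open scoped Manifold ContDiff Topology

noncomputable section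

namespace ClosingClam

section General

variable {E : Type*} [NormedAddCommGroup E] [NormedSpace ℝ E]
  {H : Type*} [TopologicalSpace H] (I : ModelWithCorners ℝ E H)
  (N : Type*) [TopologicalSpace N] [ChartedSpace H N]

/-- The smooth (`C^∞`) diffeomorphisms of a manifold `N`, possibly with boundary. -/
abbrev Diff : Type _ := N ≃ₘ^∞⟮I, I⟯ N

/-- `Diff(N)` is a group under composition: `(φ * ψ) p = φ (ψ p)`. -/
instance instGroupDiff : Group (Diff I N) where
  mul φ ψ := ψ.trans φ
  one := Diffeomorph.refl I N ∞
  inv φ := φ.symm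
  mul_assoc _ _ _ := rfl
  one_mul _ := rfl
  mul_one _ := rfl
  inv_mul_cancel φ := Diffeomorph.ext fun x => φ.symm_apply_apply x

variable {I N}

@[simp] theorem mul_apply (φ ψ : Diff I N) (p : N) : (φ * ψ) p = φ (ψ p) := rfl

@[simp] theorem one_apply (p : N) : (1 : Diff I N) p = p := rfl

@[simp] theorem inv_apply_self (φ : Diff I N) (p : N) : φ⁻¹ (φ p) = p := φ.symm_apply_apply p

@[simp] theorem apply_inv_self (φ : Diff I N) (p : N) : φ (φ⁻¹ p) = p := φ.apply_symm_apply p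

/-- A smooth isotopy of `N`: a family `h t` (`0 ≤ t ≤ 1`) of diffeomorphisms such that
`(t, p) ↦ h t p` and `(t, p) ↦ (h t)⁻¹ p` are smooth on `[0,1] × N`, that is, a smooth level
preserving diffeomorphism of `[0,1] × N`. -/
def IsIsotopy (h : unitInterval → Diff I N) : Prop :=
  ContMDiff ((𝓡∂ 1).prod I) I ∞ (fun p : unitInterval × N => h p.1 p.2) ∧
    ContMDiff ((𝓡∂ 1).prod I) I ∞ (fun p : unitInterval × N => (h p.1)⁻¹ p.2)

/-- Two diffeomorphisms are isotopic if a smooth isotopy joins them. -/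
def Isotopic (φ ψ : Diff I N) : Prop :=
  ∃ h : unitInterval → Diff I N, IsIsotopy h ∧ h 0 = φ ∧ h 1 = ψ

theorem isIsotopy_const (φ : Diff I N) : IsIsotopy (fun _ => φ) :=
  ⟨φ.contMDiff.comp contMDiff_snd, φ.symm.contMDiff.comp contMDiff_snd⟩

theorem IsIsotopy.inv {h : unitInterval → Diff I N} (hh : IsIsotopy h) :
    IsIsotopy (fun t => (h t)⁻¹) := ⟨hh.2, by simpa using hh.1⟩

theorem IsIsotopy.mul {h k : unitInterval → Diff I N} (hh : IsIsotopy h) (hk : IsIsotopy k) :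
    IsIsotopy (fun t => h t * k t) :=
  ⟨hh.1.comp (contMDiff_fst.prodMk hk.1), by
    simp only [mul_inv_rev, mul_apply]
    exact hk.2.comp (contMDiff_fst.prodMk hh.2)⟩

variable (I N)

/-- `Diff(N)_0`: the diffeomorphisms of `N` that are isotopic to the identity. -/
def diffZero : Subgroup (Diff I N) where
  carrier := {φ | Isotopic 1 φ}
  one_mem' := ⟨fun _ => 1, isIsotopy_const 1, rfl, rfl⟩
  mul_mem' := by
    rintro _ _ ⟨h, hh, h0, rfl⟩ ⟨k, hk, k0, rfl⟩
    exact ⟨fun t => h t * k t, hh.mul hk, by simp [h0, k0], rfl⟩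
  inv_mem' := by
    rintro _ ⟨h, hh, h0, rfl⟩
    exact ⟨fun t => (h t)⁻¹, hh.inv, by simp [h0], rfl⟩

instance diffZero_normal : (diffZero I N).Normal where
  conj_mem := by
    rintro _ ⟨h, hh, h0, rfl⟩ φ
    exact ⟨fun t => φ * h t * φ⁻¹,
      ((isIsotopy_const φ).mul hh).mul (isIsotopy_const φ⁻¹), by simp [h0], rfl⟩

/-- `π₀ Diff(N)`, the group of isotopy classes of diffeomorphisms of `N`. -/
abbrev PiZeroDiff : Type _ := Diff I N ⧸ diffZero I N

/-- `Diff(N rel ∂)`: the diffeomorphisms of `N` that are the identity near the boundary of `N`. -/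
def diffRel : Subgroup (Diff I N) where
  carrier := {φ | ∀ᶠ p in 𝓝ˢ (I.boundary N), φ p = p}
  one_mem' := by simp
  mul_mem' := by
    intro φ ψ hφ hψ
    rw [Set.mem_ofPred_eq] at hφ hψ ⊢
    filter_upwards [hφ, hψ] with p h1 h2
    rw [mul_apply, h2, h1]
  inv_mem' := by
    intro φ hφ
    rw [Set.mem_ofPred_eq] at hφ ⊢
    filter_upwards [hφ] with p h1
    conv_lhs => rw [← h1]
    simp

variable {I N}

/-- An isotopy rel boundary: a smooth isotopy that is constantly the identity near the
boundary. -/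
def IsIsotopyRel (h : unitInterval → diffRel I N) : Prop :=
  IsIsotopy (fun t => (h t : Diff I N)) ∧
    ∀ᶠ p in 𝓝ˢ (I.boundary N), ∀ t, (h t : Diff I N) p = p

/-- Two elements of `Diff(N rel ∂)` are isotopic rel boundary if an isotopy rel boundary
joins them. -/
def IsotopicRel (g g' : diffRel I N) : Prop :=
  ∃ h : unitInterval → diffRel I N, IsIsotopyRel h ∧ h 0 = g ∧ h 1 = g'

theorem isIsotopyRel_const (g : diffRel I N) : IsIsotopyRel (fun _ => g) :=
  ⟨isIsotopy_const _, by
    have h : ∀ᶠ p in 𝓝ˢ (I.boundary N), (g : Diff I N) p = p := g.2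
    filter_upwards [h] with p hp _ using hp⟩

theorem IsIsotopyRel.inv {h : unitInterval → diffRel I N} (hh : IsIsotopyRel h) :
    IsIsotopyRel (fun t => (h t)⁻¹) :=
  ⟨hh.1.inv, by
    filter_upwards [hh.2] with p hp t
    conv_lhs => rw [← hp t]
    simp⟩

theorem IsIsotopyRel.mul {h k : unitInterval → diffRel I N} (hh : IsIsotopyRel h)
    (hk : IsIsotopyRel k) : IsIsotopyRel (fun t => h t * k t) :=
  ⟨hh.1.mul hk.1, by
    filter_upwards [hh.2, hk.2] with p hp kp t
    rw [Subgroup.coe_mul, mul_apply, kp t, hp t]⟩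

variable (I N)

/-- The elements of `Diff(N rel ∂)` that are isotopic to the identity rel boundary. -/
def diffRelZero : Subgroup (diffRel I N) where
  carrier := {g | IsotopicRel 1 g}
  one_mem' := ⟨fun _ => 1, isIsotopyRel_const 1, rfl, rfl⟩
  mul_mem' := by
    rintro _ _ ⟨h, hh, h0, rfl⟩ ⟨k, hk, k0, rfl⟩
    exact ⟨fun t => h t * k t, hh.mul hk, by simp [h0, k0], rfl⟩
  inv_mem' := by
    rintro _ ⟨h, hh, h0, rfl⟩
    exact ⟨fun t => (h t)⁻¹, hh.inv, by simp [h0], rfl⟩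

instance diffRelZero_normal : (diffRelZero I N).Normal where
  conj_mem := by
    rintro _ ⟨h, hh, h0, rfl⟩ g
    exact ⟨fun t => g * h t * g⁻¹,
      ((isIsotopyRel_const g).mul hh).mul (isIsotopyRel_const g⁻¹), by simp [h0], rfl⟩

/-- `π₀ Diff(N rel ∂)`, the group of isotopy classes rel boundary. -/
abbrev PiZeroDiffRel : Type _ := diffRel I N ⧸ diffRelZero I N

variable {I N}

/-- Two diffeomorphisms are in the same class of `π₀ Diff(N)` exactly if they are isotopic. -/
theorem mk_eq_mk_iff (φ ψ : Diff I N) :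
    (φ : PiZeroDiff I N) = (ψ : PiZeroDiff I N) ↔ Isotopic φ ψ := by
  rw [QuotientGroup.eq]
  constructor
  · rintro ⟨h, hh, h0, h1⟩
    exact ⟨fun t => φ * h t, (isIsotopy_const φ).mul hh, by simp [h0], by simp [h1]⟩
  · rintro ⟨h, hh, rfl, rfl⟩
    exact ⟨fun t => (h 0)⁻¹ * h t, (isIsotopy_const _).mul hh, by simp, rfl⟩

/-- The same for `π₀ Diff(N rel ∂)`. -/
theorem mk_eq_mk_rel_iff (g g' : diffRel I N) :
    (g : PiZeroDiffRel I N) = (g' : PiZeroDiffRel I N) ↔ IsotopicRel g g' := by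
  rw [QuotientGroup.eq]
  constructor
  · rintro ⟨h, hh, h0, h1⟩
    exact ⟨fun t => g * h t, (isIsotopyRel_const g).mul hh, by simp [h0], by simp [h1]⟩
  · rintro ⟨h, hh, rfl, rfl⟩
    exact ⟨fun t => (h 0)⁻¹ * h t, (isIsotopyRel_const _).mul hh, by simp, rfl⟩

end General

/-! The circle as the interval with its end points identified. -/

/-- The quotient map `[0,1] → S¹`, `s ↦ exp(2πis)`. -/
def wrap (s : unitInterval) : Circle := Circle.exp (2 * Real.pi * s)

/-- The angle of `z`, as a fraction in `(0,1]` of a full turn. -/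
def angle (z : Circle) : ℝ := 1 / 2 + Complex.arg (-(z : ℂ)) / (2 * Real.pi)

theorem angle_mem (z : Circle) : angle z ∈ Set.Icc (0 : ℝ) 1 := by
  have h1 := Complex.neg_pi_lt_arg (-(z : ℂ))
  have h2 := Complex.arg_le_pi (-(z : ℂ))
  have hp := Real.pi_pos
  have e : angle z = (Real.pi + Complex.arg (-(z : ℂ))) / (2 * Real.pi) := by
    unfold angle; field_simp
  rw [e]
  constructor
  · apply div_nonneg <;> linarith
  · rw [div_le_one (by linarith)]; linarith

/-- A section of `wrap`, smooth away from `1 : S¹`. -/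
def cut (z : Circle) : unitInterval := Set.projIcc 0 1 zero_le_one (angle z)

theorem coe_cut (z : Circle) : (cut z : ℝ) = angle z := by
  rw [cut, Set.projIcc_of_mem zero_le_one (angle_mem z)]

theorem wrap_cut (z : Circle) : wrap (cut z) = z := by
  have hp := Real.pi_pos
  apply Circle.ext
  have e : 2 * Real.pi * angle z = Real.pi + Complex.arg (-(z : ℂ)) := by
    unfold angle; field_simp
  have h := Complex.norm_mul_exp_arg_mul_I (-(z : ℂ))
  rw [norm_neg, Circle.norm_coe, Complex.ofReal_one, one_mul] at h
  rw [wrap, coe_cut, e, Circle.coe_exp]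
  push_cast
  rw [add_mul, Complex.exp_add, Complex.exp_pi_mul_I, h]
  simp

/-- `wrap` identifies nothing but the two end points. -/
theorem wrap_eq_wrap {s t : unitInterval} (h : wrap s = wrap t) :
    s = t ∨ (s = 0 ∨ s = 1) ∧ (t = 0 ∨ t = 1) := by
  have hp := Real.pi_pos
  rw [wrap, wrap, Circle.exp_eq_exp] at h
  obtain ⟨m, hm⟩ := h
  have e : (s : ℝ) = t + m := by
    have : (2 * Real.pi) * (s : ℝ) = (2 * Real.pi) * (t + m) := by rw [hm]; ring
    exact mul_left_cancel₀ (by positivity) this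
  have s0 := s.2.1
  have s1 := s.2.2
  have t0 := t.2.1
  have t1 := t.2.2
  have m1 : m < 2 := by
    have : (m : ℝ) < 2 := by linarith
    exact_mod_cast this
  have m2 : -2 < m := by
    have : (-2 : ℝ) < m := by linarith
    exact_mod_cast this
  have hm3 : m = -1 ∨ m = 0 ∨ m = 1 := by omega
  rcases hm3 with rfl | rfl | rfl
  · right
    push_cast at e
    exact ⟨Or.inl (Subtype.ext (by show (s : ℝ) = 0; linarith)),
      Or.inr (Subtype.ext (by show (t : ℝ) = 1; linarith))⟩
  · left
    exact Subtype.ext (by simpa using e)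
  · right
    push_cast at e
    exact ⟨Or.inr (Subtype.ext (by show (s : ℝ) = 1; linarith)),
      Or.inl (Subtype.ext (by show (t : ℝ) = 0; linarith))⟩

theorem wrap_zero : wrap 0 = 1 := by simp [wrap]

theorem wrap_one : wrap 1 = 1 := by simp [wrap]

theorem contMDiff_wrap : ContMDiff (𝓡∂ 1) (𝓡 1) ∞ wrap :=
  contMDiff_circleExp.comp
    ((contDiff_const.mul contDiff_id).contMDiff.comp contMDiff_subtypeVal_Icc)

attribute [local instance] finrank_real_complex_fact' in
theorem contMDiffAt_cut {z : Circle} (hz : z ≠ 1) : ContMDiffAt (𝓡 1) (𝓡∂ 1) ∞ cut z := by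
  have hc : ContMDiff (𝓡 1) 𝓘(ℝ, ℂ) ∞ (fun w : Circle => (w : ℂ)) := contMDiff_coe_sphere
  have hs : -(z : ℂ) ∈ Complex.slitPlane := by
    by_contra h
    rw [Complex.mem_slitPlane_iff, not_or, not_lt, not_not, Complex.neg_re, Complex.neg_im] at h
    have h1 := Circle.normSq_coe z
    rw [Complex.normSq_apply] at h1
    have him : (z : ℂ).im = 0 := by linarith [h.2]
    have hre : (z : ℂ).re = 1 := by
      rw [him] at h1
      nlinarith [h.1]
    exact hz (Circle.ext (Complex.ext (by simpa using hre) (by simpa using him)))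
  have hl : ContDiffAt ℝ ∞ (fun w : ℂ => 1 / 2 + Complex.arg (-w) / (2 * Real.pi)) (z : ℂ) := by
    have h1 : ContDiffAt ℝ ∞ (fun w : ℂ => Complex.log (-w)) (z : ℂ) :=
      ((Complex.contDiffAt_log hs).restrict_scalars ℝ).comp _ contDiff_neg.contDiffAt
    have h2 : ContDiffAt ℝ ∞ (fun w : ℂ => Complex.arg (-w)) (z : ℂ) := by
      have := Complex.imCLM.contDiff.contDiffAt.comp _ h1
      refine this.congr_of_eventuallyEq (Filter.Eventually.of_forall fun w => ?_)
      simp [Complex.log_im]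
    exact contDiffAt_const.add (h2.div_const _)
  have ha : ContMDiffAt (𝓡 1) 𝓘(ℝ, ℝ) ∞ angle z := hl.contMDiffAt.comp z hc.contMDiffAt
  have hp := contMDiffOn_projIcc (x := (0 : ℝ)) (y := 1) (n := ∞) (angle z) (angle_mem z)
  rw [← contMDiffWithinAt_univ] at ha ⊢
  exact hp.comp z ha fun w _ => angle_mem w

theorem tendsto_cut : Filter.Tendsto cut (𝓝 1) (𝓝 0 ⊔ 𝓝 1) := by
  intro V hV
  have hV' : V ∈ 𝓝ˢ ({0, 1} : Set unitInterval) := by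
    rw [nhdsSet_insert, nhdsSet_singleton]
    exact hV
  obtain ⟨U, hU, h01, hUV⟩ := mem_nhdsSet_iff_exists.1 hV'
  have hK : IsClosed (wrap '' Uᶜ) :=
    (hU.isClosed_compl.isCompact.image contMDiff_wrap.continuous).isClosed
  have h1 : (1 : Circle) ∉ wrap '' Uᶜ := by
    rintro ⟨s, hs, h⟩
    apply hs
    rcases wrap_eq_wrap (h.trans wrap_zero.symm) with rfl | ⟨rfl | rfl, -⟩
    · exact h01 (by simp)
    · exact h01 (by simp)
    · exact h01 (by simp)
  rw [Filter.mem_map]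
  filter_upwards [hK.isOpen_compl.mem_nhds h1] with z hz
  apply hUV
  by_contra h
  exact hz ⟨cut z, h, wrap_cut z⟩

section Glue

variable {n : ℕ} {M : Type*} [TopologicalSpace M] [ChartedSpace (EuclideanSpace ℝ (Fin n)) M]

/-- The quotient map `M × I → M × S¹` that identifies the top `M × 1` with the bottom `M × 0`. -/
def glueEnds {X : Type*} (p : X × unitInterval) : X × Circle := (p.1, wrap p.2)

theorem glueEnds_surjective {X : Type*} :
    Function.Surjective (glueEnds : X × unitInterval → X × Circle) :=
  fun w => ⟨(w.1, cut w.2), Prod.ext rfl (wrap_cut w.2)⟩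

theorem contMDiff_glueEnds :
    ContMDiff ((𝓡 n).prod (𝓡∂ 1)) ((𝓡 n).prod (𝓡 1)) ∞ (glueEnds (X := M)) :=
  contMDiff_fst.prodMk (contMDiff_wrap.comp contMDiff_snd)

theorem boundary_cylinder : ((𝓡 n).prod (𝓡∂ 1)).boundary (M × unitInterval) =
    (Set.univ : Set M) ×ˢ ({0, 1} : Set unitInterval) :=
  boundary_product (𝓡 n)

theorem mem_nhds_of_boundary {V : Set (M × unitInterval)}
    (hV : V ∈ 𝓝ˢ (((𝓡 n).prod (𝓡∂ 1)).boundary (M × unitInterval))) {s : unitInterval}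
    (hs : s = 0 ∨ s = 1) (x : M) : V ∈ 𝓝 (x, s) := by
  rw [boundary_cylinder] at hV
  exact mem_nhdsSet_iff_forall.1 hV (x, s) ⟨trivial, hs⟩

/-- The map of `M × S¹` induced by a map of `M × I`. -/
def glueMap (f : M × unitInterval → M × unitInterval) (w : M × Circle) : M × Circle :=
  glueEnds (f (w.1, cut w.2))

theorem apply_of_end (g : diffRel ((𝓡 n).prod (𝓡∂ 1)) (M × unitInterval)) {s : unitInterval}
    (hs : s = 0 ∨ s = 1) (x : M) : g.1 (x, s) = (x, s) := by
  have h := mem_of_mem_nhds (mem_nhds_of_boundary g.2 hs x)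
  exact h

theorem glueMap_glueEnds (g : diffRel ((𝓡 n).prod (𝓡∂ 1)) (M × unitInterval))
    (p : M × unitInterval) : glueMap g.1 (glueEnds p) = glueEnds (g.1 p) := by
  obtain ⟨x, s⟩ := p
  rcases wrap_eq_wrap (wrap_cut (wrap s)) with h | ⟨h, h'⟩
  · simp [glueMap, glueEnds, h]
  · simp only [glueMap, glueEnds]
    rw [apply_of_end g h', apply_of_end g h]
    simp [wrap_cut]

theorem contMDiff_glueMap {h : unitInterval → diffRel ((𝓡 n).prod (𝓡∂ 1)) (M × unitInterval)}
    (hh : IsIsotopyRel h) :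
    ContMDiff ((𝓡∂ 1).prod ((𝓡 n).prod (𝓡 1))) ((𝓡 n).prod (𝓡 1)) ∞
      (fun p : unitInterval × (M × Circle) => glueMap (h p.1).1 p.2) := by
  rintro ⟨t, x, z⟩
  by_cases hz : z = 1
  · subst hz
    have h0 := mem_nhds_of_boundary hh.2 (Or.inl rfl) x
    have h1 := mem_nhds_of_boundary hh.2 (Or.inr rfl) x
    have ht : Filter.Tendsto (fun w : M × Circle => (w.1, cut w.2)) (𝓝 (x, 1))
        (𝓝 (x, 0) ⊔ 𝓝 (x, 1)) := by
      rw [nhds_prod_eq, nhds_prod_eq, nhds_prod_eq, ← Filter.prod_sup]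
      exact Filter.tendsto_id.prodMap tendsto_cut
    have hw : ∀ᶠ w in 𝓝 ((x, 1) : M × Circle), ∀ t : unitInterval,
        (h t).1 (w.1, cut w.2) = (w.1, cut w.2) :=
      ht.eventually (Filter.eventually_sup.2 ⟨h0, h1⟩)
    have hs : ContMDiffAt ((𝓡∂ 1).prod ((𝓡 n).prod (𝓡 1))) ((𝓡 n).prod (𝓡 1)) ∞
        (fun p : unitInterval × (M × Circle) => p.2) (t, x, 1) := contMDiffAt_snd
    refine hs.congr_of_eventuallyEq ?_
    have hc : Filter.Tendsto (fun p : unitInterval × (M × Circle) => p.2) (𝓝 (t, x, 1))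
        (𝓝 (x, 1)) := continuous_snd.continuousAt
    filter_upwards [hc.eventually hw] with p hp
    rw [glueMap, hp p.1]
    exact Prod.ext rfl (wrap_cut p.2.2)
  · have hcut : ContMDiffAt ((𝓡∂ 1).prod ((𝓡 n).prod (𝓡 1))) (𝓡∂ 1) ∞
        (fun p : unitInterval × (M × Circle) => cut p.2.2) (t, x, z) :=
      ContMDiffAt.comp (t, x, z) (f := fun p : unitInterval × (M × Circle) => p.2.2)
        (contMDiffAt_cut hz) (contMDiff_snd.comp contMDiff_snd).contMDiffAt
    have hin : ContMDiffAt ((𝓡∂ 1).prod ((𝓡 n).prod (𝓡 1)))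
        ((𝓡∂ 1).prod ((𝓡 n).prod (𝓡∂ 1))) ∞
        (fun p : unitInterval × (M × Circle) => (p.1, (p.2.1, cut p.2.2))) (t, x, z) :=
      contMDiffAt_fst.prodMk
        ((contMDiff_fst.comp contMDiff_snd).contMDiffAt.prodMk hcut)
    exact (contMDiff_glueEnds.comp hh.1.1).contMDiffAt.comp (t, x, z) hin

theorem contMDiff_glueMap_const (g : diffRel ((𝓡 n).prod (𝓡∂ 1)) (M × unitInterval)) :
    ContMDiff ((𝓡 n).prod (𝓡 1)) ((𝓡 n).prod (𝓡 1)) ∞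
      (glueMap g.1) :=
  (contMDiff_glueMap (isIsotopyRel_const g)).comp
    (contMDiff_const (c := (0 : unitInterval)).prodMk contMDiff_id)

/-- The closure of a diffeomorphism `g` of `M × I` rel boundary: the diffeomorphism of `M × S¹`
obtained from `g` by identifying top and bottom. -/
def closeUp (g : diffRel ((𝓡 n).prod (𝓡∂ 1)) (M × unitInterval)) :
    Diff ((𝓡 n).prod (𝓡 1)) (M × Circle) where
  toFun := glueMap g.1
  invFun := glueMap (g⁻¹).1
  left_inv w := by
    obtain ⟨p, rfl⟩ := glueEnds_surjective w
    rw [glueMap_glueEnds, glueMap_glueEnds]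
    simp
  right_inv w := by
    obtain ⟨p, rfl⟩ := glueEnds_surjective w
    rw [glueMap_glueEnds, glueMap_glueEnds]
    simp
  contMDiff_toFun := contMDiff_glueMap_const g
  contMDiff_invFun := contMDiff_glueMap_const g⁻¹

/-- The closure of `g` is the unique map that `g` induces on the quotient `M × S¹`. -/
theorem closeUp_glueEnds (g : diffRel ((𝓡 n).prod (𝓡∂ 1)) (M × unitInterval))
    (p : M × unitInterval) : closeUp g (glueEnds p) = glueEnds (g.1 p) :=
  glueMap_glueEnds g p

variable (n M)

/-- The homomorphism `Diff(M × I rel ∂) → Diff(M × S¹)` that identifies top and bottom. -/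
def closeUpHom : diffRel ((𝓡 n).prod (𝓡∂ 1)) (M × unitInterval) →*
    Diff ((𝓡 n).prod (𝓡 1)) (M × Circle) :=
  MonoidHom.mk' closeUp fun g g' => Diffeomorph.ext fun w => by
    obtain ⟨p, rfl⟩ := glueEnds_surjective w
    rw [mul_apply, closeUp_glueEnds, closeUp_glueEnds, closeUp_glueEnds]
    simp

theorem diffRelZero_le_comap : diffRelZero ((𝓡 n).prod (𝓡∂ 1)) (M × unitInterval) ≤
    (diffZero ((𝓡 n).prod (𝓡 1)) (M × Circle)).comap (closeUpHom n M) := by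
  rintro _ ⟨h, hh, h0, rfl⟩
  exact ⟨fun t => closeUpHom n M (h t),
    ⟨contMDiff_glueMap hh, contMDiff_glueMap hh.inv⟩, by simp [h0], rfl⟩

/-- The homomorphism `π₀ Diff(M × I rel ∂) → π₀ Diff(M × S¹)` that `closeUpHom` induces. -/
def piZeroCloseUp : PiZeroDiffRel ((𝓡 n).prod (𝓡∂ 1)) (M × unitInterval) →*
    PiZeroDiff ((𝓡 n).prod (𝓡 1)) (M × Circle) :=
  QuotientGroup.map _ _ (closeUpHom n M) (diffRelZero_le_comap n M)

end Glue

end ClosingClam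

end

open scoped Manifold ContDiff Topology

noncomputable section

/-! Lift the given isotopy of M × S¹ to M × ℝ. The result is a periodic isotopy F that starts at the
identity and, after an integer translation, ends at the periodic extension of g: a copy of g in
every M × [m, m + 1] (`exists_periodicIsotopy`).

For a compactly supported cut-off τ on ℝ let P_τ(x, s) = F((x, s), τ(s)). By compactness of M and
periodicity, the ℝ-coordinate of the inverse of F is uniformly Lipschitz in time. So P_τ is a
diffeomorphism as soon as τ varies slowly, and scaling τ down to 0 joins P_τ to the identity with
compact support (`IsPeriodicIsotopy.exists_slow_twist`).

Now take two such cut-offs with τ'(s) = τ(s) for s ≤ 1 and τ'(s + 1) = τ(s) for s ≥ 0. Then P_τ' is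
P_τ with one more copy of g inserted at M × [0, 1]. If S is the diffeomorphism opening a gap of
length 1 just above M × 0, then P_τ' S P_τ⁻¹ S⁻¹ is g on M × [0, 1] and the identity elsewhere.
Scaling both cut-offs down turns this product into S S⁻¹ = 1, which gives an isotopy with compact
support in M × ℝ (`IsPeriodicIsotopy.exists_compact`).

That support may exceed M × [0, 1]. Since g is the identity in collars of width ε, conjugation by a
diffeomorphism of ℝ that fixes [ε, 1 - ε] and stretches the collars over the whole support pushes
the isotopy into the interior of M × [0, 1] without changing its end
(`IsPeriodicIsotopy.exists_compact_Icc`). -/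

namespace ClosingClam

/-! ### Implicit functions and Lipschitz bounds in one real variable -/

section ScalarCalculus

variable {E : Type*} [NormedAddCommGroup E] [NormedSpace ℝ E]
  {H : Type*} [TopologicalSpace H] {I : ModelWithCorners ℝ E H} [I.Boundaryless]
  {N : Type*} [TopologicalSpace N] [ChartedSpace H N] [IsManifold I ∞ N]

theorem contDiffAt_comp_extChartAt_symm {f : N × ℝ → ℝ} {q : N} {u : ℝ}
    (hf : ContMDiffAt (I.prod 𝓘(ℝ, ℝ)) 𝓘(ℝ, ℝ) ∞ f (q, u)) :
    ContDiffAt ℝ ∞ (fun p : E × ℝ => f ((extChartAt I q).symm p.1, p.2))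
      (extChartAt I q q, u) := by
  rw [← contMDiffAt_iff_contDiffAt]
  have hs : ContMDiffAt 𝓘(ℝ, E) I ∞ (extChartAt I q).symm (extChartAt I q q) :=
    (contMDiffOn_extChartAt_symm q).contMDiffAt (extChartAt_target_mem_nhds q)
  have h1 : ContMDiffAt 𝓘(ℝ, E × ℝ) I ∞ (fun p : E × ℝ => (extChartAt I q).symm p.1)
      (extChartAt I q q, u) :=
    ContMDiffAt.comp (extChartAt I q q, u) (g := (extChartAt I q).symm)
      (f := fun p : E × ℝ => p.1) hs contDiff_fst.contMDiff.contMDiffAt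
  have h2 : ContMDiffAt 𝓘(ℝ, E × ℝ) 𝓘(ℝ, ℝ) ∞ (fun p : E × ℝ => p.2)
      (extChartAt I q q, u) := contDiff_snd.contMDiff.contMDiffAt
  exact ContMDiffAt.comp_of_eq (g := f) hf (h1.prodMk h2) (by simp)

/-- A scalar equation that is strictly increasing in the unknown, at a uniform rate, has a unique
solution, and the solution depends smoothly on the parameters. -/
theorem exists_contMDiff_zero {F : N × ℝ → ℝ}
    (hF : ContMDiff (I.prod 𝓘(ℝ, ℝ)) 𝓘(ℝ, ℝ) ∞ F) [CompleteSpace E] {c : ℝ} (hc : 0 < c)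
    (hmono : ∀ q u v, u ≤ v → c * (v - u) ≤ F (q, v) - F (q, u)) :
    ∃ u : N → ℝ, ContMDiff I 𝓘(ℝ, ℝ) ∞ u ∧ ∀ q v, F (q, v) = 0 ↔ v = u q := by
  have hcont (q : N) : Continuous fun v => F (q, v) := hF.continuous.comp (by fun_prop)
  have hstrict (q : N) : StrictMono fun v => F (q, v) := fun u v huv => by
    have := hmono q u v huv.le
    have := mul_pos hc (sub_pos.2 huv)
    simp only
    linarith
  -- Growth at rate at least `c` forces a zero within distance |F (q, 0)| / c of 0.
  have hex (q : N) : ∃ v, F (q, v) = 0 := by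
    set a := F (q, 0) with ha
    have h1 := hmono q 0 (|a| / c) (by positivity)
    have h2 := hmono q (-(|a| / c)) 0 (by simp; positivity)
    have h3 : c * (|a| / c) = |a| := by field_simp
    rw [sub_zero, h3, ← ha] at h1
    rw [sub_neg_eq_add, zero_add, h3, ← ha] at h2
    have := neg_abs_le a
    have := le_abs_self a
    obtain ⟨v, -, hv⟩ := intermediate_value_Icc (a := -(|a| / c)) (b := |a| / c)
      (by have : 0 ≤ |a| / c := by positivity
          linarith) (hcont q).continuousOn
      (show (0 : ℝ) ∈ Set.Icc _ _ from ⟨by linarith, by linarith⟩)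
    exact ⟨v, hv⟩
  choose u hu using hex
  have huniq (q : N) (v : ℝ) : F (q, v) = 0 ↔ v = u q :=
    ⟨fun h => (hstrict q).injective (h.trans (hu q).symm), fun h => h ▸ hu q⟩
  refine ⟨u, fun q => ?_, huniq⟩
  set G : E × ℝ → ℝ := fun p => F ((extChartAt I q).symm p.1, p.2) with hG
  have hcd : ContDiffAt ℝ ∞ G (extChartAt I q q, u q) :=
    contDiffAt_comp_extChartAt_symm (hF _)
  have hG0 : G (extChartAt I q q, u q) = 0 := by simp [hG, hu]
  -- The partial derivative in the unknown is at least `c`, because F (q, v) - c * v is still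
  -- monotone in v.
  have hne : (fderiv ℝ G (extChartAt I q q, u q) ∘L .inr ℝ E ℝ) 1 ≠ 0 := by
    have hd : HasDerivAt (fun v => F (q, v))
        ((fderiv ℝ G (extChartAt I q q, u q) ∘L .inr ℝ E ℝ) 1) (u q) := by
      have h1 := (hcd.differentiableAt (by simp)).hasFDerivAt.comp (u q)
        (hasFDerivAt_prodMk_right (𝕜 := ℝ) (extChartAt I q q) (u q))
      have h2 := h1.hasDerivAt
      refine h2.congr_of_eventuallyEq (Filter.Eventually.of_forall fun v => ?_)
      simp [hG]
    have h3 : MonotoneOn (fun v => F (q, v) - c * v) Set.univ := fun a _ b _ hab => by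
      have := hmono q a b hab
      simp only
      linarith
    have h4 : 0 ≤ deriv (fun v => F (q, v) - c * v) (u q) :=
      (monotoneOn_univ.1 h3).deriv_nonneg
    have h5 := (hd.sub ((hasDerivAt_id (u q)).const_mul c)).deriv
    have h6 : deriv (fun v => F (q, v) - c * v) (u q) = _ := h5
    rw [h6] at h4
    intro h0
    rw [h0] at h4
    linarith
  have hinv : (fderiv ℝ G (extChartAt I q q, u q) ∘L .inr ℝ E ℝ).IsInvertible := by
    refine ⟨ContinuousLinearEquiv.unitsEquivAut ℝ (Units.mk0 _ hne), ?_⟩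
    ext
    simp
  have hψ := hcd.contDiffAt_implicitFunction (by simp) hinv
  have hev := hcd.eventually_apply_implicitFunction (by simp) hinv
  rw [hG0] at hev
  -- Zeros are unique globally, so the pointwise choice `u` must coincide with the local implicit
  -- function.
  have hev' : ∀ᶠ q' in 𝓝 q, u q' = hcd.implicitFunction (by simp) hinv (extChartAt I q q') := by
    filter_upwards [(continuousAt_extChartAt (I := I) q).eventually hev,
      extChartAt_source_mem_nhds (I := I) q] with q' h1 h2
    simp only [hG] at h1
    rw [(extChartAt I q).left_inv h2] at h1
    exact ((huniq _ _).1 h1).symm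
  refine ContMDiffAt.congr_of_eventuallyEq ?_ hev'
  exact ContMDiffAt.comp q hψ.contMDiffAt contMDiffAt_extChartAt

/-- In a chart this derivative is the Fréchet derivative applied to (0, 1). Its continuity makes it
bounded on compact sets. -/
theorem continuous_deriv_snd {f : N × ℝ → ℝ}
    (hf : ContMDiff (I.prod 𝓘(ℝ, ℝ)) 𝓘(ℝ, ℝ) ∞ f) :
    Continuous fun p : N × ℝ => deriv (fun u => f (p.1, u)) p.2 := by
  rw [continuous_iff_continuousAt]
  rintro ⟨q, u⟩
  set G : E × ℝ → ℝ := fun p => f ((extChartAt I q).symm p.1, p.2) with hG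
  have hcd : ContDiffAt ℝ ∞ G (extChartAt I q q, u) :=
    contDiffAt_comp_extChartAt_symm (hf _)
  have hc : ContinuousAt (fun p : N × ℝ => (extChartAt I q p.1, p.2)) (q, u) :=
    ((continuousAt_extChartAt (I := I) q).comp continuousAt_fst).prodMk continuousAt_snd
  have hfd : ContinuousAt (fun x => fderiv ℝ G x (0, 1)) (extChartAt I q q, u) :=
    ((hcd.fderiv_right (m := 0) (by simp)).continuousAt).clm_apply continuousAt_const
  have hdiff : ∀ᶠ x in 𝓝 (extChartAt I q q, u), DifferentiableAt ℝ G x := by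
    have := (hcd.of_le (m := 1) (by simp)).eventually (by simp)
    filter_upwards [this] with x hx using hx.differentiableAt (by simp)
  have h1 : ContinuousAt (fun p : N × ℝ => fderiv ℝ G (extChartAt I q p.1, p.2) (0, 1)) (q, u) :=
    ContinuousAt.comp (g := fun x => fderiv ℝ G x (0, 1))
      (f := fun p : N × ℝ => (extChartAt I q p.1, p.2)) hfd hc
  refine h1.congr ?_
  have hsrc : ∀ᶠ p : N × ℝ in 𝓝 (q, u), p.1 ∈ (extChartAt I q).source :=
    continuousAt_fst.eventually (extChartAt_source_mem_nhds (I := I) q)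
  filter_upwards [hc.eventually hdiff, hsrc] with p hp hs
  have h2 := (hp.hasFDerivAt.comp p.2
    (hasFDerivAt_prodMk_right (𝕜 := ℝ) (extChartAt I q p.1) p.2)).hasDerivAt.deriv
  have e : (G ∘ fun u => (extChartAt I q p.1, u)) = fun u => f (p.1, u) := by
    ext v
    simp only [hG, Function.comp_apply, (extChartAt I q).left_inv hs]
  rw [e] at h2
  rw [h2]
  simp

/-- A smooth function is Lipschitz in a real variable, uniformly on compact sets. -/
theorem exists_lipschitz_snd {f : N × ℝ → ℝ}
    (hf : ContMDiff (I.prod 𝓘(ℝ, ℝ)) 𝓘(ℝ, ℝ) ∞ f) {K : Set N} (hK : IsCompact K) (a b : ℝ) :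
    ∃ C : ℝ, 0 ≤ C ∧ ∀ q ∈ K, ∀ u ∈ Set.Icc a b, ∀ v ∈ Set.Icc a b,
      |f (q, u) - f (q, v)| ≤ C * |u - v| := by
  obtain ⟨C, hC⟩ := (hK.prod (isCompact_Icc (a := a) (b := b))).exists_bound_of_continuousOn
    (continuous_deriv_snd hf).continuousOn
  refine ⟨max C 0, le_max_right _ _, fun q hq u hu v hv => ?_⟩
  have hd : ∀ w, DifferentiableAt ℝ (fun u => f (q, u)) w := by
    have h : ContMDiff 𝓘(ℝ, ℝ) 𝓘(ℝ, ℝ) ∞ (fun u => f (q, u)) :=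
      hf.comp (contMDiff_const.prodMk contMDiff_id)
    exact fun w => h.contDiff.differentiable (by simp) w
  have := (convex_Icc a b).norm_image_sub_le_of_norm_deriv_le (f := fun u => f (q, u))
    (C := max C 0) (fun w _ => hd w) (fun w hw => (hC (q, w) ⟨hq, hw⟩).trans (le_max_left _ _))
    hv hu
  simpa using this

end ScalarCalculus

/-! ### Cut-off functions and diffeomorphisms of the real line -/

section RealFunctions

open Real (smoothTransition)

theorem exists_lipschitz_smoothTransition :
    ∃ C : ℝ, 0 < C ∧ ∀ a b, |smoothTransition a - smoothTransition b| ≤ C * |a - b| := by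
  have hf : ContMDiff (𝓘(ℝ, ℝ).prod 𝓘(ℝ, ℝ)) 𝓘(ℝ, ℝ) ∞
      (fun p : ℝ × ℝ => smoothTransition p.2) :=
    (Real.smoothTransition.contDiff (n := ⊤)).contMDiff.comp contMDiff_snd
  obtain ⟨C, hC0, hC⟩ := exists_lipschitz_snd hf (isCompact_singleton (x := (0 : ℝ))) 0 1
  refine ⟨C + 1, by linarith, fun a b => ?_⟩
  have h := hC 0 rfl _ (Set.projIcc (0 : ℝ) 1 zero_le_one a).2 _
    (Set.projIcc (0 : ℝ) 1 zero_le_one b).2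
  simp only [Real.smoothTransition.projIcc] at h
  refine h.trans (mul_le_mul (by linarith) ?_ (abs_nonneg _) (by linarith))
  exact Set.abs_projIcc_sub_projIcc zero_le_one

/-- Two slowly varying compactly supported cut-off functions, the second of which stays equal to
`1` for one more unit of length than the first. -/
theorem exists_slow_cutoffs {c : ℝ} (hc : 0 < c) :
    ∃ (τ : Bool → ℝ → ℝ) (L : ℝ), (∀ i, ContDiff ℝ ∞ (τ i)) ∧
      (∀ i a b, |τ i a - τ i b| ≤ c * |a - b|) ∧ (∀ i s, L ≤ |s| → τ i s = 0) ∧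
      (∀ s ∈ Set.Icc (-1 : ℝ) 1, τ false s = 1) ∧ (∀ s ≤ 1, τ true s = τ false s) ∧
      ∀ s, 0 ≤ s → τ true (s + 1) = τ false s := by
  obtain ⟨C, hC0, hC⟩ := exists_lipschitz_smoothTransition
  -- Each of the two ramps below has Lipschitz constant C * η and values in [0, 1], so their product
  -- has constant 2 * C * η ≤ c. The bound η ≤ 1 keeps both ramps equal to 1 on [-1, 1].
  set η := min 1 (c / (2 * C)) with hη
  have hη0 : 0 < η := by positivity
  have hη1 : η ≤ 1 := min_le_left _ _
  have hηc : 2 * (C * η) ≤ c := by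
    have : η ≤ c / (2 * C) := min_le_right _ _
    rw [le_div_iff₀ (by positivity)] at this
    linarith
  let j : Bool → ℝ := fun i => bif i then 1 else 0
  have hj (i : Bool) : 0 ≤ j i ∧ j i ≤ 1 := by cases i <;> simp [j]
  have hη2 : η * (2 / η) = 2 := by field_simp
  -- The first factor rises on [-2/η, -1/η]; the second falls on [j + 1/η, j + 2/η]. Only the
  -- descent depends on `i`: it starts one unit later for `true`.
  refine ⟨fun i s => smoothTransition (2 + η * s) * smoothTransition (2 + η * (j i - s)),
    2 / η + 1, fun i => ?_, fun i a b => ?_, fun i s hs => ?_, fun s hs => ?_, fun s hs => ?_,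
    fun s hs => ?_⟩
  · exact ((Real.smoothTransition.contDiff (n := ⊤)).comp (by fun_prop)).mul
      ((Real.smoothTransition.contDiff (n := ⊤)).comp (by fun_prop))
  · set p := smoothTransition (2 + η * a)
    set q := smoothTransition (2 + η * (j i - a))
    set p' := smoothTransition (2 + η * b)
    set q' := smoothTransition (2 + η * (j i - b))
    have hp : |p - p'| ≤ C * (η * |a - b|) := by
      have := hC (2 + η * a) (2 + η * b)
      rwa [add_sub_add_left_eq_sub, ← mul_sub, abs_mul, abs_of_pos hη0] at this
    have hq : |q - q'| ≤ C * (η * |a - b|) := by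
      have := hC (2 + η * (j i - a)) (2 + η * (j i - b))
      rwa [add_sub_add_left_eq_sub, ← mul_sub, abs_mul, abs_of_pos hη0,
        sub_sub_sub_cancel_left, abs_sub_comm b a] at this
    have hq1 : |q| ≤ 1 := abs_le.2 ⟨by linarith [Real.smoothTransition.nonneg (2 + η * (j i - a))],
      Real.smoothTransition.le_one _⟩
    have hp1 : |p'| ≤ 1 := abs_le.2 ⟨by linarith [Real.smoothTransition.nonneg (2 + η * b)],
      Real.smoothTransition.le_one _⟩
    calc |p * q - p' * q'| = |(p - p') * q + p' * (q - q')| := by ring_nf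
      _ ≤ |(p - p') * q| + |p' * (q - q')| := abs_add_le _ _
      _ = |p - p'| * |q| + |p'| * |q - q'| := by rw [abs_mul, abs_mul]
      _ ≤ |p - p'| * 1 + 1 * |q - q'| := by gcongr
      _ ≤ 2 * (C * η) * |a - b| := by linarith
      _ ≤ c * |a - b| := by gcongr
  · have h2 : 0 < 2 / η := by positivity
    rcases le_abs.1 hs with h | h
    · have : η * (j i - s) ≤ η * (-(2 / η)) := by
        gcongr
        linarith [(hj i).2]
      simp only
      rw [Real.smoothTransition.zero_of_nonpos (x := 2 + η * (j i - s)) (by linarith), mul_zero]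
    · have : η * s ≤ η * (-(2 / η)) := by
        gcongr
        linarith
      simp only
      rw [Real.smoothTransition.zero_of_nonpos (x := 2 + η * s) (by linarith), zero_mul]
  · have h1 : η * (-1) ≤ η * s := by gcongr; exact hs.1
    have h2 : η * s ≤ η * 1 := by gcongr; exact hs.2
    simp only [j, cond_false]
    rw [Real.smoothTransition.one_of_one_le (by linarith),
      Real.smoothTransition.one_of_one_le (by linarith), mul_one]
  · have h2 : η * s ≤ η * 1 := by gcongr
    simp only [j, cond_false, cond_true]
    rw [Real.smoothTransition.one_of_one_le (x := 2 + η * (1 - s)) (by linarith),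
      Real.smoothTransition.one_of_one_le (x := 2 + η * (0 - s)) (by linarith)]
  · have h2 : 0 ≤ η * s := by positivity
    simp only [j, cond_false, cond_true]
    rw [Real.smoothTransition.one_of_one_le (x := 2 + η * (s + 1)) (by linarith),
      Real.smoothTransition.one_of_one_le (x := 2 + η * s) (by linarith)]
    congr 2
    ring

/-- Adding a smooth increasing function to the identity of `ℝ` gives a diffeomorphism of `ℝ`. -/
theorem exists_contDiff_inverse {m : ℝ → ℝ} (hm : ContDiff ℝ ∞ m) (hmono : Monotone m) :
    ∃ k : ℝ → ℝ, ContDiff ℝ ∞ k ∧ (∀ s, k (s + m s) = s) ∧ ∀ s, k s + m (k s) = s := by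
  have hF : ContMDiff (𝓘(ℝ, ℝ).prod 𝓘(ℝ, ℝ)) 𝓘(ℝ, ℝ) ∞
      (fun p : ℝ × ℝ => p.2 + m p.2 - p.1) :=
    (contMDiff_snd.add (hm.contMDiff.comp contMDiff_snd)).sub contMDiff_fst
  obtain ⟨k, hk, h⟩ := exists_contMDiff_zero hF one_pos fun q u v huv => by
    have := hmono huv
    simp only
    linarith
  simp only [sub_eq_zero] at h
  exact ⟨k, hk.contDiff, fun s => ((h _ s).1 rfl).symm, fun s => (h s _).2 rfl⟩

/-- A diffeomorphism of `ℝ` that opens a gap of length `1` at `(0, ε)`. -/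
theorem exists_gap {ε : ℝ} (hε : 0 < ε) :
    ∃ σ k : ℝ → ℝ, ContDiff ℝ ∞ σ ∧ ContDiff ℝ ∞ k ∧ (∀ s, k (σ s) = s) ∧ (∀ s, σ (k s) = s) ∧
      (∀ s ≤ 0, σ s = s) ∧ (∀ s, ε ≤ s → σ s = s + 1) ∧
      ∀ s, σ s ∈ Set.Icc s (s + 1) := by
  have hm : ContDiff ℝ ∞ (fun s => smoothTransition (s / ε)) :=
    (Real.smoothTransition.contDiff (n := ⊤)).comp (contDiff_id.div_const ε)
  have hmono : Monotone (fun s => smoothTransition (s / ε)) := fun a b hab =>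
    Real.smoothTransition.monotone (by gcongr)
  obtain ⟨k, hk, h1, h2⟩ := exists_contDiff_inverse hm hmono
  refine ⟨_, k, contDiff_id.add hm, hk, h1, h2, fun s hs => ?_, fun s hs => ?_, fun s => ?_⟩
  · simp [Real.smoothTransition.zero_of_nonpos (div_nonpos_of_nonpos_of_nonneg hs hε.le)]
  · simp [Real.smoothTransition.one_of_one_le ((one_le_div hε).2 hs)]
  · have := Real.smoothTransition.nonneg (s / ε)
    have := Real.smoothTransition.le_one (s / ε)
    exact ⟨by simp only [id]; linarith, by simp only [id]; linarith⟩

/-- A diffeomorphism of `ℝ` that is the identity on `[ε, 1 - ε]` and maps the complement of a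
smaller neighborhood of this interval out of `[-L, L]`. -/
theorem exists_stretch {ε : ℝ} (hε : 0 < ε) (hε' : ε ≤ 1 / 2) (L : ℝ) :
    ∃ φ k : ℝ → ℝ, ContDiff ℝ ∞ φ ∧ ContDiff ℝ ∞ k ∧ (∀ s, k (φ s) = s) ∧ (∀ s, φ (k s) = s) ∧
      (∀ s ∈ Set.Icc ε (1 - ε), φ s = s) ∧
      ∀ s ∉ Set.Icc (ε / 2) (1 - ε / 2), L ≤ |φ s| := by
  -- The map will be s - b left of ε/2 and s + b right of 1 - ε/2; the extra 1 outweighs s itself.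
  set b := |L| + 1 with hb
  have hb0 : 0 < b := by positivity
  set m : ℝ → ℝ := fun s => b * (smoothTransition ((s - (1 - ε)) / (ε / 2)) -
    smoothTransition ((ε - s) / (ε / 2))) with hmdef
  have hm : ContDiff ℝ ∞ m :=
    contDiff_const.mul (((Real.smoothTransition.contDiff (n := ⊤)).comp (by fun_prop)).sub
      ((Real.smoothTransition.contDiff (n := ⊤)).comp (by fun_prop)))
  have hmono : Monotone m := fun s t hst => by
    have h1 : smoothTransition ((s - (1 - ε)) / (ε / 2)) ≤
        smoothTransition ((t - (1 - ε)) / (ε / 2)) :=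
      Real.smoothTransition.monotone (by gcongr)
    have h2 : smoothTransition ((ε - t) / (ε / 2)) ≤ smoothTransition ((ε - s) / (ε / 2)) :=
      Real.smoothTransition.monotone (by gcongr)
    exact mul_le_mul_of_nonneg_left (by linarith) hb0.le
  obtain ⟨k, hk, h1, h2⟩ := exists_contDiff_inverse hm hmono
  refine ⟨_, k, contDiff_id.add hm, hk, h1, h2, fun s hs => ?_, fun s hs => ?_⟩
  · simp only [hmdef, id]
    rw [Real.smoothTransition.zero_of_nonpos
        (div_nonpos_of_nonpos_of_nonneg (by linarith [hs.2]) (by positivity)),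
      Real.smoothTransition.zero_of_nonpos
        (div_nonpos_of_nonpos_of_nonneg (by linarith [hs.1]) (by positivity))]
    simp
  · have hL := le_abs_self L
    rw [Set.mem_Icc, not_and_or, not_le, not_le] at hs
    simp only [hmdef, id]
    rcases hs with hs | hs
    · rw [Real.smoothTransition.zero_of_nonpos
          (div_nonpos_of_nonpos_of_nonneg (by linarith) (by positivity)),
        Real.smoothTransition.one_of_one_le ((one_le_div (by positivity)).2 (by linarith))]
      exact le_abs.2 (Or.inr (by linarith))
    · rw [Real.smoothTransition.one_of_one_le ((one_le_div (by positivity)).2 (by linarith)),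
        Real.smoothTransition.zero_of_nonpos
          (div_nonpos_of_nonpos_of_nonneg (by linarith) (by positivity))]
      exact le_abs.2 (Or.inl (by linarith))

end RealFunctions

/-! ### Periodic isotopies of M × ℝ and their cut-offs -/

section Periodic

variable {n : ℕ} {M : Type*} [TopologicalSpace M] [ChartedSpace (EuclideanSpace ℝ (Fin n)) M]

variable (n) in
/-- A smooth isotopy `t ↦ F (·, t)` of `M × ℝ` with inverse `t ↦ K (·, t)` that starts at the
identity, ends at time `1`, and commutes with the unit translation of `ℝ`. -/
structure IsPeriodicIsotopy (F K : (M × ℝ) × ℝ → M × ℝ) : Prop where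
  contMDiff : ContMDiff (((𝓡 n).prod 𝓘(ℝ, ℝ)).prod 𝓘(ℝ, ℝ)) ((𝓡 n).prod 𝓘(ℝ, ℝ)) ∞ F
  contMDiff_inv : ContMDiff (((𝓡 n).prod 𝓘(ℝ, ℝ)).prod 𝓘(ℝ, ℝ)) ((𝓡 n).prod 𝓘(ℝ, ℝ)) ∞ K
  left_inv : ∀ p t, K (F (p, t), t) = p
  right_inv : ∀ p t, F (K (p, t), t) = p
  apply_of_nonpos : ∀ p t, t ≤ 0 → F (p, t) = p
  apply_of_one_le : ∀ p t, 1 ≤ t → F (p, t) = F (p, 1)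
  apply_add_one : ∀ x s t, F ((x, s + 1), t) = ((F ((x, s), t)).1, (F ((x, s), t)).2 + 1)

variable (n) in
/-- A smooth family of diffeomorphisms `Q (r, ·)` of `M × ℝ`, with inverses `R (r, ·)`. -/
structure IsDiffFamily (Q R : ℝ × (M × ℝ) → M × ℝ) : Prop where
  contMDiff : ContMDiff (𝓘(ℝ, ℝ).prod ((𝓡 n).prod 𝓘(ℝ, ℝ))) ((𝓡 n).prod 𝓘(ℝ, ℝ)) ∞ Q
  contMDiff_inv : ContMDiff (𝓘(ℝ, ℝ).prod ((𝓡 n).prod 𝓘(ℝ, ℝ))) ((𝓡 n).prod 𝓘(ℝ, ℝ)) ∞ R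
  left_inv : ∀ r p, R (r, Q (r, p)) = p
  right_inv : ∀ r p, Q (r, R (r, p)) = p

namespace IsDiffFamily

variable {Q R Q' R' : ℝ × (M × ℝ) → M × ℝ}

theorem symm (h : IsDiffFamily n Q R) : IsDiffFamily n R Q :=
  ⟨h.contMDiff_inv, h.contMDiff, h.right_inv, h.left_inv⟩

theorem comp (h : IsDiffFamily n Q R) (h' : IsDiffFamily n Q' R') :
    IsDiffFamily n (fun p => Q (p.1, Q' p)) (fun p => R' (p.1, R p)) where
  contMDiff := h.contMDiff.comp (contMDiff_fst.prodMk h'.contMDiff)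
  contMDiff_inv := h'.contMDiff_inv.comp (contMDiff_fst.prodMk h.contMDiff_inv)
  left_inv r p := by simp [h.left_inv, h'.left_inv]
  right_inv r p := by simp [h.right_inv, h'.right_inv]

theorem apply_inv_of_apply (h : IsDiffFamily n Q R) {r : ℝ} {p : M × ℝ} (hp : Q (r, p) = p) :
    R (r, p) = p := by
  conv_lhs => rw [← hp]
  exact h.left_inv r p

theorem of_real {σ k : ℝ → ℝ} (hσ : ContDiff ℝ ∞ σ) (hk : ContDiff ℝ ∞ k)
    (h1 : ∀ s, k (σ s) = s) (h2 : ∀ s, σ (k s) = s) :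
    IsDiffFamily n (fun p : ℝ × (M × ℝ) => (p.2.1, σ p.2.2)) (fun p => (p.2.1, k p.2.2)) where
  contMDiff := (contMDiff_fst.comp contMDiff_snd).prodMk
    (hσ.contMDiff.comp (contMDiff_snd.comp contMDiff_snd))
  contMDiff_inv := (contMDiff_fst.comp contMDiff_snd).prodMk
    (hk.contMDiff.comp (contMDiff_snd.comp contMDiff_snd))
  left_inv r p := by simp [h1]
  right_inv r p := by simp [h2]

end IsDiffFamily

namespace IsPeriodicIsotopy

variable {F K : (M × ℝ) × ℝ → M × ℝ}

theorem inv_apply_of_nonpos (h : IsPeriodicIsotopy n F K) (p : M × ℝ) {t : ℝ} (ht : t ≤ 0) :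
    K (p, t) = p := by
  have := h.left_inv p t
  rwa [h.apply_of_nonpos p t ht] at this

theorem inv_apply_of_one_le (h : IsPeriodicIsotopy n F K) (p : M × ℝ) {t : ℝ} (ht : 1 ≤ t) :
    K (p, t) = K (p, 1) := by
  conv_lhs => rw [← h.right_inv p 1, ← h.apply_of_one_le _ t ht]
  exact h.left_inv _ t

theorem symm (h : IsPeriodicIsotopy n F K) : IsPeriodicIsotopy n K F where
  contMDiff := h.contMDiff_inv
  contMDiff_inv := h.contMDiff
  left_inv := h.right_inv
  right_inv := h.left_inv
  apply_of_nonpos p _ ht := h.inv_apply_of_nonpos p ht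
  apply_of_one_le p _ ht := h.inv_apply_of_one_le p ht
  apply_add_one x s t := by
    have h1 := h.apply_add_one (K ((x, s), t)).1 (K ((x, s), t)).2 t
    rw [Prod.mk.eta, h.right_inv] at h1
    rw [← h1, h.left_inv]

theorem inv_apply_projIcc (h : IsPeriodicIsotopy n F K) (p : M × ℝ) (t : ℝ) :
    K (p, t) = K (p, (Set.projIcc (0 : ℝ) 1 zero_le_one t : ℝ)) := by
  rcases le_total t 0 with h0 | h0
  · rw [Set.projIcc_of_le_left _ h0, h.inv_apply_of_nonpos p h0, h.inv_apply_of_nonpos p le_rfl]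
  · rcases le_total t 1 with h1 | h1
    · rw [Set.projIcc_of_mem _ ⟨h0, h1⟩]
    · rw [Set.projIcc_of_right_le _ h1, h.inv_apply_of_one_le p h1]

theorem apply_add_int (h : IsPeriodicIsotopy n F K) (x : M) (s t : ℝ) (m : ℤ) :
    F ((x, s + m), t) = ((F ((x, s), t)).1, (F ((x, s), t)).2 + m) := by
  induction m using Int.induction_on with
  | zero => simp
  | succ i ih =>
    have := h.apply_add_one x (s + (i : ℤ)) t
    rw [ih] at this
    push_cast at this ⊢
    rw [← add_assoc, this, add_assoc]
  | pred i ih =>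
    have := h.apply_add_one x (s + (-(i : ℤ) - 1 : ℤ)) t
    push_cast at this ih ⊢
    rw [show s + (-(i : ℝ) - 1) + 1 = s + -i by ring, ih, Prod.mk.injEq] at this
    exact Prod.ext this.1.symm (by simp only; linarith [this.2])

variable [IsManifold (𝓡 n) ∞ M]

/-- Periodicity reduces s to its fractional part and constancy in time outside [0, 1] reduces t to
[0, 1], so a bound on the compact set M × [0, 1] × [0, 1] suffices. -/
theorem exists_lipschitz [CompactSpace M] (h : IsPeriodicIsotopy n F K) :
    ∃ C : ℝ, 0 < C ∧ ∀ q u v, |(K (q, u)).2 - (K (q, v)).2| ≤ C * |u - v| := by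
  have hf : ContMDiff (((𝓡 n).prod 𝓘(ℝ, ℝ)).prod 𝓘(ℝ, ℝ)) 𝓘(ℝ, ℝ) ∞ (fun p => (K p).2) :=
    contMDiff_snd.comp h.contMDiff_inv
  obtain ⟨C, hC0, hC⟩ := exists_lipschitz_snd hf
    ((isCompact_univ (X := M)).prod (isCompact_Icc (a := (0 : ℝ)) (b := 1))) 0 1
  refine ⟨C + 1, by linarith, ?_⟩
  rintro ⟨x, s⟩ u v
  have h1 := hC (x, Int.fract s) ⟨trivial, Int.fract_nonneg s, (Int.fract_lt_one s).le⟩ _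
    (Set.projIcc (0 : ℝ) 1 zero_le_one u).2 _ (Set.projIcc (0 : ℝ) 1 zero_le_one v).2
  simp only [← h.inv_apply_projIcc] at h1
  have h2 := congrArg Prod.snd (h.symm.apply_add_int x (Int.fract s) u ⌊s⌋)
  have h3 := congrArg Prod.snd (h.symm.apply_add_int x (Int.fract s) v ⌊s⌋)
  rw [Int.fract_add_floor] at h2 h3
  rw [h2, h3, add_sub_add_right_eq_sub]
  refine h1.trans (mul_le_mul (by linarith) ?_ (abs_nonneg _) (by linarith))
  exact Set.abs_projIcc_sub_projIcc zero_le_one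

/-- If `τ` varies slowly, then `(x, s) ↦ F ((x, s), τ s)` is a diffeomorphism, and so it is with
`τ` scaled down by a factor in `[0, 1]`. -/
theorem exists_slow_twist (h : IsPeriodicIsotopy n F K) {C c : ℝ} (hc : 0 ≤ c)
    (hC : ∀ q u v, |(K (q, u)).2 - (K (q, v)).2| ≤ C * |u - v|) (hcC : c * C ≤ 1 / 2)
    {τ : ℝ → ℝ} (hτ : ContDiff ℝ ∞ τ) (hτc : ∀ a b, |τ a - τ b| ≤ c * |a - b|) :
    ∃ R : ℝ × (M × ℝ) → M × ℝ, IsDiffFamily n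
      (fun p => F (p.2, Real.smoothTransition p.1 * τ p.2.2)) R := by
  have hst : ContDiff ℝ ∞ Real.smoothTransition := Real.smoothTransition.contDiff (n := ⊤)
  -- To invert the twist at q, find the time u that was used there: the preimage is K (q, u), so u
  -- must equal the scaled cut-off at the height of K (q, u). The cut-off term has Lipschitz
  -- constant at most c * C ≤ 1/2 in u, so the difference of the two sides increases at rate at
  -- least 1/2.
  have hG : ContMDiff ((𝓘(ℝ, ℝ).prod ((𝓡 n).prod 𝓘(ℝ, ℝ))).prod 𝓘(ℝ, ℝ)) 𝓘(ℝ, ℝ) ∞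
      (fun p : (ℝ × (M × ℝ)) × ℝ =>
        p.2 - Real.smoothTransition p.1.1 * τ (K (p.1.2, p.2)).2) := by
    have h1 : ContMDiff ((𝓘(ℝ, ℝ).prod ((𝓡 n).prod 𝓘(ℝ, ℝ))).prod 𝓘(ℝ, ℝ)) 𝓘(ℝ, ℝ) ∞
        (fun p : (ℝ × (M × ℝ)) × ℝ => Real.smoothTransition p.1.1) :=
      hst.contMDiff.comp (contMDiff_fst.comp contMDiff_fst)
    have h2 : ContMDiff ((𝓘(ℝ, ℝ).prod ((𝓡 n).prod 𝓘(ℝ, ℝ))).prod 𝓘(ℝ, ℝ)) 𝓘(ℝ, ℝ) ∞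
        (fun p : (ℝ × (M × ℝ)) × ℝ => τ (K (p.1.2, p.2)).2) :=
      hτ.contMDiff.comp (contMDiff_snd.comp
        (h.contMDiff_inv.comp ((contMDiff_snd.comp contMDiff_fst).prodMk contMDiff_snd)))
    exact contMDiff_snd.sub (h1.mul h2)
  obtain ⟨u, hu, huniq⟩ := exists_contMDiff_zero hG (c := 1 / 2) (by norm_num) (by
    rintro ⟨r, q⟩ a b hab
    simp only
    set S := Real.smoothTransition r
    have hS0 : 0 ≤ S := Real.smoothTransition.nonneg r
    have hS1 : S ≤ 1 := Real.smoothTransition.le_one r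
    have h1 : |τ (K (q, b)).2 - τ (K (q, a)).2| ≤ 1 / 2 * (b - a) := by
      calc _ ≤ c * |(K (q, b)).2 - (K (q, a)).2| := hτc _ _
        _ ≤ c * (C * |b - a|) := by gcongr; exact hC _ _ _
        _ = (c * C) * (b - a) := by rw [abs_of_nonneg (sub_nonneg.2 hab)]; ring
        _ ≤ 1 / 2 * (b - a) := by gcongr
    have h2 : S * (τ (K (q, b)).2 - τ (K (q, a)).2) ≤ 1 * (1 / 2 * (b - a)) :=
      (mul_le_mul_of_nonneg_left ((le_abs_self _).trans h1) hS0).trans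
        (mul_le_mul_of_nonneg_right hS1 (by linarith))
    linarith)
  simp only [sub_eq_zero] at huniq
  refine ⟨fun p => K (p.2, u p), ?_, ?_, fun r p => ?_, fun r p => ?_⟩
  · have h1 : ContMDiff (𝓘(ℝ, ℝ).prod ((𝓡 n).prod 𝓘(ℝ, ℝ))) 𝓘(ℝ, ℝ) ∞
        (fun p : ℝ × (M × ℝ) => Real.smoothTransition p.1) := hst.contMDiff.comp contMDiff_fst
    have h2 : ContMDiff (𝓘(ℝ, ℝ).prod ((𝓡 n).prod 𝓘(ℝ, ℝ))) 𝓘(ℝ, ℝ) ∞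
        (fun p : ℝ × (M × ℝ) => τ p.2.2) :=
      hτ.contMDiff.comp (contMDiff_snd.comp contMDiff_snd)
    exact h.contMDiff.comp (contMDiff_snd.prodMk (h1.mul h2))
  · exact h.contMDiff_inv.comp (contMDiff_snd.prodMk hu)
  · simp only
    rw [← (huniq (r, F (p, Real.smoothTransition r * τ p.2))
      (Real.smoothTransition r * τ p.2)).1 (by rw [h.left_inv]), h.left_inv]
  · simp only
    rw [← (huniq (r, p) (u (r, p))).2 rfl, h.right_inv]

end IsPeriodicIsotopy

/-- An injective map of `M × ℝ` that is the identity far away and on `M × a` preserves the two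
sides of `M × a`. -/
theorem snd_lt_iff_of_fixes {f : M × ℝ → M × ℝ} (hf : Continuous f) (hinj : Function.Injective f)
    {a L : ℝ} (ha : ∀ x, f (x, a) = (x, a)) (hL : ∀ p : M × ℝ, L ≤ |p.2| → f p = p)
    (p : M × ℝ) : a < (f p).2 ↔ a < p.2 := by
  obtain ⟨x, s⟩ := p
  -- The level M × a is already the image of itself, so by injectivity no other point lands on it. A
  -- point changing sides would, by the intermediate value theorem along its line toward the region
  -- where f is the identity, produce such a point.
  have hne : ∀ t, t ≠ a → (f (x, t)).2 ≠ a := fun t ht h => by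
    have h1 := ha (f (x, t)).1
    rw [← h, Prod.mk.eta] at h1
    have := congrArg Prod.snd (hinj h1)
    exact ht (this.symm.trans h)
  have hc : Continuous fun t => (f (x, t)).2 := by fun_prop
  rcases lt_trichotomy s a with hs | rfl | hs
  · simp only [not_lt.2 hs.le, iff_false, not_lt]
    by_contra! hlt
    set b := min s (-|L|) with hb
    have hbs : b ≤ s := min_le_left _ _
    have hfb : f (x, b) = (x, b) := hL _ (by
      have : b ≤ -|L| := min_le_right _ _
      exact le_abs.2 (Or.inr (by simp only; linarith [le_abs_self L])))
    obtain ⟨t, ht, h⟩ := intermediate_value_Icc hbs hc.continuousOn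
      (show a ∈ Set.Icc _ _ from ⟨by rw [hfb]; linarith, hlt.le⟩)
    exact hne t (by linarith [ht.2] : t < a).ne h
  · simp [ha]
  · simp only [hs, iff_true]
    by_contra! hlt
    set b := max s |L| with hb
    have hbs : s ≤ b := le_max_left _ _
    have hfb : f (x, b) = (x, b) := hL _ (by
      have : |L| ≤ b := le_max_right _ _
      exact le_abs.2 (Or.inl (by simp only; linarith [le_abs_self L])))
    obtain ⟨t, ht, h⟩ := intermediate_value_Icc hbs hc.continuousOn
      (show a ∈ Set.Icc _ _ from ⟨hlt, by rw [hfb]; linarith⟩)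
    exact hne t (by linarith [ht.1] : a < t).ne' h

variable [CompactSpace M] [IsManifold (𝓡 n) ∞ M] {F K : (M × ℝ) × ℝ → M × ℝ}

/-- The end of a periodic isotopy of `M × ℝ`, if it is the identity near `M × 0`, cut off outside
`M × [0, 1]`, is isotopic to the identity with compact support. -/
theorem IsPeriodicIsotopy.exists_compact (h : IsPeriodicIsotopy n F K) {ε : ℝ} (hε : 0 < ε)
    (hε' : ε ≤ 1 / 2) (h0 : ∀ x, ∀ s ∈ Set.Icc 0 ε, F ((x, s), 1) = (x, s)) :
    ∃ (Q R : ℝ × (M × ℝ) → M × ℝ) (L : ℝ), IsDiffFamily n Q R ∧ (∀ p, Q (0, p) = p) ∧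
      (∀ r p, L ≤ |p.2| → Q (r, p) = p) ∧ (∀ p, p.2 ∈ Set.Icc 0 1 → Q (1, p) = F (p, 1)) ∧
      ∀ p, p.2 ∉ Set.Icc 0 1 → Q (1, p) = p := by
  obtain ⟨C, hC0, hC⟩ := h.exists_lipschitz
  obtain ⟨τ, L, hτ, hτc, hτL, hτ1, hττ, hττ'⟩ :=
    exists_slow_cutoffs (c := 1 / (2 * C)) (by positivity)
  have hcC : 1 / (2 * C) * C ≤ 1 / 2 := le_of_eq (by field_simp)
  have hex (i : Bool) := h.exists_slow_twist (by positivity) hC hcC (hτ i) (hτc i)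
  choose R hR using hex
  set P : Bool → ℝ × (M × ℝ) → M × ℝ := fun i p => F (p.2, Real.smoothTransition p.1 * τ i p.2.2)
    with hPdef
  have hP : ∀ i, IsDiffFamily n (P i) (R i) := hR
  have hPL (i : Bool) (r : ℝ) (p : M × ℝ) (hp : L ≤ |p.2|) : P i (r, p) = p := by
    simp [hPdef, hτL i _ hp, h.apply_of_nonpos]
  have hP0 (i : Bool) (p : M × ℝ) : P i (0, p) = p := by
    simp [hPdef, h.apply_of_nonpos]
  have hP1 (i : Bool) (p : M × ℝ) : P i (1, p) = F (p, τ i p.2) := by simp [hPdef]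
  have hPone (p : M × ℝ) (hp : p.2 ∈ Set.Icc (-1 : ℝ) 1) : P true (1, p) = F (p, 1) := by
    rw [hP1, hττ _ hp.2, hτ1 _ hp]
  have hPadd (x : M) (s : ℝ) (hs : 0 ≤ s) : P true (1, (x, s + 1)) =
      ((P false (1, (x, s))).1, (P false (1, (x, s))).2 + 1) := by
    rw [hP1, hP1, h.apply_add_one, hττ' s hs]
  have hPε (x : M) (s : ℝ) (hs : s ∈ Set.Icc 0 ε) : P false (1, (x, s)) = (x, s) := by
    rw [hP1, hτ1 s ⟨by linarith [hs.1], by linarith [hs.2]⟩, h0 x s hs]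
  have hPcont : Continuous fun p => P false (1, p) :=
    (hP false).contMDiff.continuous.comp (by fun_prop)
  have hPinj : Function.Injective fun p => P false (1, p) :=
    Function.LeftInverse.injective (g := fun p => R false (1, p)) ((hP false).left_inv 1)
  have hside (a : ℝ) (ha : a ∈ Set.Icc 0 ε) (p : M × ℝ) : a < (P false (1, p)).2 ↔ a < p.2 :=
    snd_lt_iff_of_fixes hPcont hPinj (fun x => hPε x a ha) (hPL false 1) p
  obtain ⟨σ, k, hσ, hk, hkσ, hσk, hσ0, hσε, hσI⟩ := exists_gap hε
  have hS : IsDiffFamily n (fun p : ℝ × (M × ℝ) => (p.2.1, σ p.2.2)) (fun p => (p.2.1, k p.2.2)) :=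
    .of_real hσ hk hkσ hσk
  have hk' (s : ℝ) (hs : |L| + 1 ≤ |s|) : L ≤ |k s| := by
    have h1 := hσI (k s)
    rw [hσk] at h1
    have h2 := abs_sub_abs_le_abs_sub s (k s)
    have h3 : |s - k s| ≤ 1 := abs_le.2 ⟨by linarith [h1.1], by linarith [h1.2]⟩
    linarith [le_abs_self L]
  -- The product P_τ' S P_τ⁻¹ S⁻¹, with τ' = `τ true` and τ = `τ false`. Since S moves heights by at
  -- most 1, its support grows by at most 1 beyond that of the twists.
  refine ⟨_, _, |L| + 1, (hP true).comp (hS.comp ((hP false).symm.comp hS.symm)), fun p => ?_,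
    fun r p hp => ?_, ?_⟩
  · have : R false (0, (p.1, k p.2)) = (p.1, k p.2) :=
      (hP false).apply_inv_of_apply (hP0 false _)
    simp [hP0, hσk, this]
  · have h1 : R false (r, (p.1, k p.2)) = (p.1, k p.2) :=
      (hP false).apply_inv_of_apply (hPL false r _ (hk' _ hp))
    simp only [h1, hσk, Prod.mk.eta]
    exact hPL _ _ _ (by linarith [le_abs_self L])
  · suffices hmain : ∀ p : M × ℝ,
        P true (1, ((R false (1, (p.1, k p.2))).1, σ (R false (1, (p.1, k p.2))).2)) =
          if p.2 ∈ Set.Icc (0 : ℝ) 1 then F (p, 1) else p from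
      ⟨fun p hp => (hmain p).trans (if_pos hp), fun p hp => (hmain p).trans (if_neg hp)⟩
    rintro ⟨y, v⟩
    -- Let w = (x, s) be the preimage of S⁻¹(y, v) under P_τ. The levels 0 and ε are preserved
    -- together with their sides, so s and k v lie in the same one of the three ranges s ≤ 0, 0 < s
    -- ≤ ε, s > ε.
    have hw := (hP false).right_inv 1 (y, k v)
    simp only
    generalize R false (1, (y, k v)) = w at hw ⊢
    obtain ⟨x, s⟩ := w
    simp only
    have hs0 := hside 0 ⟨le_rfl, hε.le⟩ (x, s)
    have hsε := hside ε ⟨hε.le, le_rfl⟩ (x, s)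
    rw [hw] at hs0 hsε
    simp only at hs0 hsε
    -- Below 0 the two twists agree and S is trivial, so everything cancels.
    rcases le_or_gt s 0 with h1 | h1
    · have hv0 : k v ≤ 0 := not_lt.1 (mt hs0.1 (not_lt.2 h1))
      have hv : v = k v := by
        have := hσ0 _ hv0
        rwa [hσk] at this
      rw [hσ0 s h1, hP1, hττ s (by linarith), ← hP1, hw, ← hv]
      split_ifs with h2
      · have : v = 0 := le_antisymm (hv ▸ hv0) h2.1
        rw [h0 y v ⟨h2.1, by linarith⟩]
      · rfl
    · rcases le_or_gt s ε with h2 | h2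
      -- Inside the gap P_τ is the identity, so only P_τ' remains: it is the end of F for v in [0,
      -- 1], and the identity for v in (1, 1 + ε], where it is a translate of P_τ on (0, ε].
      · rw [hPε x s ⟨h1.le, h2⟩, Prod.mk.injEq] at hw
        obtain ⟨rfl, rfl⟩ := hw
        rw [hσk]
        have h3 := hσI (k v)
        rw [hσk] at h3
        split_ifs with h4
        · exact hPone _ ⟨by linarith [h4.1], h4.2⟩
        · have h5 : 1 < v := by
            by_contra! hle
            exact h4 ⟨by linarith [h3.1], hle⟩
          have h6 := hPadd x (v - 1) (by linarith)
          rwa [hPε x (v - 1) ⟨by linarith, by linarith [h3.2]⟩, sub_add_cancel] at h6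
      -- Above the gap S is the unit translation, which carries P_τ to P_τ', so everything cancels
      -- again.
      · have h3 : v = k v + 1 := by
          have := hσε _ (hsε.2 h2).le
          rwa [hσk] at this
        rw [hσε s h2.le, hPadd x s h1.le, hw, if_neg]
        · rw [← h3]
        · intro h4
          have := h4.2
          have := hsε.2 h2
          linarith

/-- As before, with the support of the isotopy contained in the interior of `M × [0, 1]`. -/
theorem IsPeriodicIsotopy.exists_compact_Icc (h : IsPeriodicIsotopy n F K) {ε : ℝ} (hε : 0 < ε)
    (hε' : ε ≤ 1 / 2) (h0 : ∀ x, ∀ s ∈ Set.Icc 0 ε, F ((x, s), 1) = (x, s))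
    (h1 : ∀ x, ∀ s ∈ Set.Icc (1 - ε) 1, F ((x, s), 1) = (x, s)) :
    ∃ Q R : ℝ × (M × ℝ) → M × ℝ, IsDiffFamily n Q R ∧ (∀ p, Q (0, p) = p) ∧
      (∀ r p, p.2 ∉ Set.Icc (ε / 2) (1 - ε / 2) → Q (r, p) = p) ∧
      ∀ p, p.2 ∈ Set.Icc 0 1 → Q (1, p) = F (p, 1) := by
  obtain ⟨Q, R, L, hQ, hQ0, hQL, hQF, hQ1⟩ := h.exists_compact hε hε' h0
  obtain ⟨φ, k, hφ, hk, hkφ, hφk, hφε, hφL⟩ := exists_stretch hε hε' L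
  have hS : IsDiffFamily n (fun p : ℝ × (M × ℝ) => (p.2.1, φ p.2.2)) (fun p => (p.2.1, k p.2.2)) :=
    .of_real hφ hk hkφ hφk
  have hfix (p : M × ℝ) (hp : p.2 ∉ Set.Icc ε (1 - ε)) : Q (1, p) = p := by
    by_cases h2 : p.2 ∈ Set.Icc 0 1
    · rw [hQF p h2]
      rw [Set.mem_Icc, not_and_or, not_le, not_le] at hp
      rcases hp with hp | hp
      · exact h0 p.1 p.2 ⟨h2.1, hp.le⟩
      · exact h1 p.1 p.2 ⟨hp.le, h2.2⟩
    · exact hQ1 p h2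
  refine ⟨_, _, hS.symm.comp (hQ.comp hS), fun p => ?_, fun r p hp => ?_, fun p hp => ?_⟩
  · simp [hQ0, hkφ]
  · simp [hQL r (p.1, φ p.2) (hφL _ hp), hkφ]
  · rw [← hQF p hp]
    by_cases h2 : p.2 ∈ Set.Icc ε (1 - ε)
    · simp only [hφε _ h2, Prod.mk.eta]
      -- A bijection that fixes every point outside the band maps the band into itself, and there
      -- the stretch is the identity.
      have h3 : (Q (1, p)).2 ∈ Set.Icc ε (1 - ε) := by
        by_contra h4
        have h5 := hfix _ h4
        have h6 := congrArg (fun q => R (1, q)) h5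
        simp only [hQ.left_inv] at h6
        rw [h6] at h4
        exact h4 h2
      conv_lhs => rw [← hφε _ h3, hkφ]
    · have h3 : φ p.2 ∉ Set.Icc ε (1 - ε) := fun h4 => h2 (by
        have := hφε _ h4
        have h5 := congrArg k this
        rw [hkφ, hkφ] at h5
        rwa [h5] at h4)
      rw [hfix p h2]
      simp [hfix (p.1, φ p.2) h3, hkφ]

end Periodic

/-! ### Lifting an isotopy from M × S¹ to M × ℝ -/

section Lifting

attribute [local instance] finrank_real_complex_fact' in
/-- A continuous angle function of a smooth map to the circle is smooth. -/
theorem contMDiff_of_circleExp {E : Type*} [NormedAddCommGroup E] [NormedSpace ℝ E]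
    {H : Type*} [TopologicalSpace H] {I : ModelWithCorners ℝ E H}
    {X : Type*} [TopologicalSpace X] [ChartedSpace H X] {δ : X → ℝ} (hδ : Continuous δ)
    (h : ContMDiff I (𝓡 1) ∞ fun x => Circle.exp (δ x)) : ContMDiff I 𝓘(ℝ, ℝ) ∞ δ := by
  intro a
  have hc : ContMDiff (𝓡 1) 𝓘(ℝ, ℂ) ∞ (fun w : Circle => (w : ℂ)) := contMDiff_coe_sphere
  -- Near `a` the angle is recovered by the branch of the logarithm centered at the value of the map
  -- at `a`.
  have hl : ContDiffAt ℝ ∞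
      (fun w : ℂ => δ a + (Complex.log (w * Complex.exp (-(δ a * Complex.I)))).im)
      (Circle.exp (δ a) : ℂ) := by
    have h1 : ContDiffAt ℝ ∞ (fun w : ℂ => Complex.log (w * Complex.exp (-(δ a * Complex.I))))
        (Circle.exp (δ a) : ℂ) := by
      refine ContDiffAt.comp (g := Complex.log) _
        ((Complex.contDiffAt_log ?_).restrict_scalars ℝ) (by fun_prop)
      rw [Circle.coe_exp, ← Complex.exp_add, add_neg_cancel, Complex.exp_zero]
      exact Complex.one_mem_slitPlane
    exact contDiffAt_const.add (Complex.imCLM.contDiff.contDiffAt.comp _ h1)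
  have h2 : ContMDiffAt I 𝓘(ℝ, ℝ) ∞ (fun x => δ a +
      (Complex.log ((Circle.exp (δ x) : ℂ) * Complex.exp (-(δ a * Complex.I)))).im) a :=
    ContMDiffAt.comp (f := fun x => (Circle.exp (δ x) : ℂ)) a hl.contMDiffAt (hc.comp h a)
  refine h2.congr_of_eventuallyEq ?_
  filter_upwards [hδ.continuousAt.eventually (Metric.ball_mem_nhds (δ a) Real.pi_pos)] with x hx
  rw [Real.dist_eq, abs_lt] at hx
  have h3 : (Circle.exp (δ x) : ℂ) * Complex.exp (-(δ a * Complex.I)) =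
      Complex.exp (((δ x - δ a : ℝ) : ℂ) * Complex.I) := by
    rw [Circle.coe_exp, ← Complex.exp_add]
    push_cast
    ring_nf
  rw [h3, Complex.log_im, Complex.arg_exp_mul_I, (toIocMod_eq_self _).2 ⟨by linarith, by linarith⟩]
  ring

/-- The universal covering of the circle with period `1`. -/
def turn (s : ℝ) : Circle := Circle.exp (2 * Real.pi * s)

theorem turn_add (s t : ℝ) : turn (s + t) = turn s * turn t := by
  rw [turn, mul_add, Circle.exp_add]; rfl

theorem turn_one : turn 1 = 1 := by simp [turn]

theorem turn_coe (s : unitInterval) : turn s = wrap s := rfl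

theorem contMDiff_turn : ContMDiff 𝓘(ℝ, ℝ) (𝓡 1) ∞ turn :=
  contMDiff_circleExp.comp (contDiff_const.mul contDiff_id).contMDiff

theorem turn_eq_turn {s t : ℝ} (h : turn s = turn t) : ∃ m : ℤ, s = t + m := by
  rw [turn, turn, Circle.exp_eq_exp] at h
  obtain ⟨m, hm⟩ := h
  refine ⟨m, mul_left_cancel₀ Real.two_pi_pos.ne' ?_⟩
  rw [hm]
  ring

/-- A smooth passage of time from `1` to `0`, constant before `0` and after `1`. -/
def rewind (t : ℝ) : unitInterval :=
  ⟨1 - Real.smoothTransition t, by linarith [Real.smoothTransition.le_one t],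
    by linarith [Real.smoothTransition.nonneg t]⟩

theorem contMDiff_rewind : ContMDiff 𝓘(ℝ, ℝ) (𝓡∂ 1) ∞ rewind := by
  rw [contMDiff_iff_comp_subtypeVal_Icc]
  have h : ContDiff ℝ ∞ fun t => 1 - Real.smoothTransition t :=
    contDiff_const.sub (Real.smoothTransition.contDiff (n := ⊤))
  exact ⟨h.continuous.subtype_mk _, h.contMDiff⟩

theorem rewind_of_nonpos {t : ℝ} (ht : t ≤ 0) : rewind t = 1 :=
  Subtype.ext (by simp [rewind, Real.smoothTransition.zero_of_nonpos ht])

theorem rewind_of_one_le {t : ℝ} (ht : 1 ≤ t) : rewind t = 0 :=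
  Subtype.ext (by simp [rewind, Real.smoothTransition.one_of_one_le ht])

variable {n : ℕ} {M : Type*} [TopologicalSpace M] [ChartedSpace (EuclideanSpace ℝ (Fin n)) M]

/-- The angle by which an isotopy that ends at the identity turns the circle factor. -/
theorem exists_turning_angle {h : unitInterval → Diff ((𝓡 n).prod (𝓡 1)) (M × Circle)}
    (hh : IsIsotopy h) (h1 : h 1 = 1) :
    ∃ δ : (M × Circle) × ℝ → ℝ,
      ContMDiff (((𝓡 n).prod (𝓡 1)).prod 𝓘(ℝ, ℝ)) 𝓘(ℝ, ℝ) ∞ δ ∧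
      (∀ w t, w.2 * turn (δ (w, t)) = (h (rewind t) w).2) ∧ (∀ w t, t ≤ 0 → δ (w, t) = 0) ∧
      ∀ w t, 1 ≤ t → δ (w, t) = δ (w, 1) := by
  -- Dividing by the circle coordinate gives a homotopy that starts at the constant 1 once time is
  -- reversed. Its lift from 0 is a function on M × S¹, so adding it to s commutes with the unit
  -- translation.
  let c : C(unitInterval × (M × Circle), Circle) :=
    ⟨fun p => (h (unitInterval.symm p.1) p.2).2 / p.2.2,
      (continuous_snd.comp (hh.1.continuous.comp
        ((unitInterval.continuous_symm.comp continuous_fst).prodMk continuous_snd))).div'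
        (continuous_snd.comp continuous_snd)⟩
  have c0 : ∀ w, c (0, w) = Circle.exp ((0 : C(M × Circle, ℝ)) w) := fun w => by
    simp [c, h1]
  let D := Circle.isCoveringMap_exp.liftHomotopy c 0 c0
  have hD : ∀ p, Circle.exp (D p) = c p := fun p =>
    congrFun (Circle.isCoveringMap_exp.liftHomotopy_lifts c 0 c0) p
  have hD0 : ∀ w, D (0, w) = 0 := fun w => Circle.isCoveringMap_exp.liftHomotopy_zero c 0 c0 w
  set Δ : (M × Circle) × ℝ → ℝ := fun p => D (unitInterval.symm (rewind p.2), p.1) with hΔ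
  have hΔc : Continuous Δ := D.continuous.comp
    ((unitInterval.continuous_symm.comp (contMDiff_rewind.continuous.comp continuous_snd)).prodMk
      continuous_fst)
  have hexp (p) : Circle.exp (Δ p) = (h (rewind p.2) p.1).2 / p.1.2 := by
    rw [hΔ, hD]
    simp [c]
  have hΔs : ContMDiff (((𝓡 n).prod (𝓡 1)).prod 𝓘(ℝ, ℝ)) 𝓘(ℝ, ℝ) ∞ Δ := by
    refine contMDiff_of_circleExp hΔc ?_
    simp only [hexp, div_eq_mul_inv]
    exact (contMDiff_snd.comp (hh.1.comp
      ((contMDiff_rewind.comp contMDiff_snd).prodMk contMDiff_fst))).mul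
      (contMDiff_snd.comp contMDiff_fst).inv
  refine ⟨fun p => Δ p / (2 * Real.pi), hΔs.div_const _, fun w t => ?_, fun w t ht => ?_,
    fun w t ht => ?_⟩
  · rw [turn, mul_div_cancel₀ _ Real.two_pi_pos.ne', hexp]
    exact mul_div_cancel _ _
  · simp [hΔ, rewind_of_nonpos ht, hD0]
  · simp [hΔ, rewind_of_one_le ht, rewind_of_one_le le_rfl]

/-- An isotopy of `M × S¹` that ends at the identity lifts to `M × ℝ`. -/
theorem exists_lift_isotopy {h : unitInterval → Diff ((𝓡 n).prod (𝓡 1)) (M × Circle)}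
    (hh : IsIsotopy h) (h1 : h 1 = 1) :
    ∃ F K : (M × ℝ) × ℝ → M × ℝ, IsPeriodicIsotopy n F K ∧
      ∀ x s, ((F ((x, s), 1)).1, turn (F ((x, s), 1)).2) = h 0 (x, turn s) := by
  obtain ⟨δ, hδ, hturn, hδ0, hδ1⟩ := exists_turning_angle hh h1
  have hp : ContMDiff (((𝓡 n).prod 𝓘(ℝ, ℝ)).prod 𝓘(ℝ, ℝ)) ((𝓡 n).prod (𝓡 1)) ∞
      (fun p : (M × ℝ) × ℝ => (p.1.1, turn p.1.2)) :=
    (contMDiff_fst.comp contMDiff_fst).prodMk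
      (contMDiff_turn.comp (contMDiff_snd.comp contMDiff_fst))
  have ht : ContMDiff (((𝓡 n).prod 𝓘(ℝ, ℝ)).prod 𝓘(ℝ, ℝ)) (𝓡∂ 1) ∞
      (fun p : (M × ℝ) × ℝ => rewind p.2) := contMDiff_rewind.comp contMDiff_snd
  have hf := hh.1.comp (ht.prodMk hp)
  have hk := hh.2.comp (ht.prodMk hp)
  have hs : ContMDiff (((𝓡 n).prod 𝓘(ℝ, ℝ)).prod 𝓘(ℝ, ℝ)) 𝓘(ℝ, ℝ) ∞
      (fun p : (M × ℝ) × ℝ => p.1.2) := contMDiff_snd.comp contMDiff_fst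
  have hproj (x : M) (s t : ℝ) : ((h (rewind t) (x, turn s)).1, turn (s + δ ((x, turn s), t))) =
      h (rewind t) (x, turn s) := Prod.ext rfl (by rw [turn_add]; exact hturn (x, turn s) t)
  refine ⟨fun p => ((h (rewind p.2) (p.1.1, turn p.1.2)).1,
      p.1.2 + δ ((p.1.1, turn p.1.2), p.2)),
    fun p => (((h (rewind p.2))⁻¹ (p.1.1, turn p.1.2)).1,
      p.1.2 - δ ((h (rewind p.2))⁻¹ (p.1.1, turn p.1.2), p.2)), ⟨?_, ?_, ?_, ?_, ?_, ?_, ?_⟩, ?_⟩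
  · exact (contMDiff_fst.comp hf).prodMk (hs.add (hδ.comp (hp.prodMk contMDiff_snd)))
  · exact (contMDiff_fst.comp hk).prodMk (hs.sub (hδ.comp (hk.prodMk contMDiff_snd)))
  · rintro ⟨x, s⟩ t
    simp only [hproj, inv_apply_self, add_sub_cancel_right]
  · rintro ⟨x, s⟩ t
    have h2 : (((h (rewind t))⁻¹ (x, turn s)).1,
        turn (s - δ ((h (rewind t))⁻¹ (x, turn s), t))) = (h (rewind t))⁻¹ (x, turn s) := by
      refine Prod.ext rfl ?_
      have h3 := hturn ((h (rewind t))⁻¹ (x, turn s)) t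
      rw [apply_inv_self] at h3
      refine mul_right_cancel (b := turn (δ ((h (rewind t))⁻¹ (x, turn s), t))) ?_
      rw [h3, ← turn_add, sub_add_cancel]
    simp only [h2, apply_inv_self, sub_add_cancel]
  · rintro ⟨x, s⟩ t ht
    simp [rewind_of_nonpos ht, h1, hδ0 _ t ht]
  · rintro ⟨x, s⟩ t ht
    simp [rewind_of_one_le ht, rewind_of_one_le le_rfl, hδ1 _ t ht]
  · intro x s t
    simp only [turn_add, turn_one, mul_one, Prod.mk.injEq, true_and]
    ring
  · intro x s
    have := hproj x s 1
    rw [rewind_of_one_le le_rfl] at this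
    simpa only [rewind_of_one_le le_rfl] using this

/-- A periodic isotopy precomposed with a gradual translation of `ℝ`. -/
theorem IsPeriodicIsotopy.comp_translate {F K : (M × ℝ) × ℝ → M × ℝ}
    (h : IsPeriodicIsotopy n F K) {κ : M → ℝ} (hκ : ContMDiff (𝓡 n) 𝓘(ℝ, ℝ) ∞ κ) :
    IsPeriodicIsotopy n
      (fun p => F ((p.1.1, p.1.2 - Real.smoothTransition p.2 * κ p.1.1), p.2))
      (fun p => ((K p).1, (K p).2 + Real.smoothTransition p.2 * κ (K p).1)) := by
  have hst : ContMDiff (((𝓡 n).prod 𝓘(ℝ, ℝ)).prod 𝓘(ℝ, ℝ)) 𝓘(ℝ, ℝ) ∞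
      (fun p : (M × ℝ) × ℝ => Real.smoothTransition p.2) :=
    (Real.smoothTransition.contDiff (n := ⊤)).contMDiff.comp contMDiff_snd
  refine ⟨?_, ?_, ?_, ?_, ?_, ?_, ?_⟩
  · exact h.contMDiff.comp (((contMDiff_fst.comp contMDiff_fst).prodMk
      ((contMDiff_snd.comp contMDiff_fst).sub
        (hst.mul (hκ.comp (contMDiff_fst.comp contMDiff_fst))))).prodMk contMDiff_snd)
  · exact (contMDiff_fst.comp h.contMDiff_inv).prodMk ((contMDiff_snd.comp h.contMDiff_inv).add
      (hst.mul (hκ.comp (contMDiff_fst.comp h.contMDiff_inv))))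
  · rintro ⟨x, s⟩ t
    simp [h.left_inv]
  · rintro p t
    simp [h.right_inv]
  · rintro p t ht
    simp [h.apply_of_nonpos _ t ht, Real.smoothTransition.zero_of_nonpos ht]
  · rintro p t ht
    simp only [Real.smoothTransition.one_of_one_le ht, Real.smoothTransition.one]
    exact h.apply_of_one_le _ t ht
  · intro x s t
    simp only
    rw [← h.apply_add_one]
    congr 3
    ring

/-- If the closure of `g` is isotopic to the identity of `M × S¹`, then the periodic extension of
`g` to `M × ℝ` is the end of a periodic isotopy. -/
theorem exists_periodicIsotopy (g : diffRel ((𝓡 n).prod (𝓡∂ 1)) (M × unitInterval))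
    (hg : Isotopic (closeUp g) 1) :
    ∃ F K : (M × ℝ) × ℝ → M × ℝ, IsPeriodicIsotopy n F K ∧
      ∀ (x : M) (s : unitInterval), F ((x, s), 1) = ((g.1 (x, s)).1, ((g.1 (x, s)).2 : ℝ)) := by
  obtain ⟨h, hh, h0, h1⟩ := hg
  obtain ⟨F, K, hF, hFg⟩ := exists_lift_isotopy hh h1
  rw [h0] at hFg
  have hFg' (x : M) (s : unitInterval) : (F ((x, s), 1)).1 = (g.1 (x, s)).1 ∧
      turn (F ((x, s), 1)).2 = turn (g.1 (x, s)).2 := by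
    have h2 := hFg x s
    have h3 := closeUp_glueEnds g (x, s)
    simp only [glueEnds, ← turn_coe] at h3
    rw [h3, Prod.mk.injEq] at h2
    exact h2
  -- The end of F and g project to the same map, so their heights differ by an integer, continuous
  -- in (x, s) and hence independent of s. As M may be disconnected, this integer may still vary
  -- with the component; being locally constant it is smooth in x.
  choose m hm using fun p : M × unitInterval => turn_eq_turn (hFg' p.1 p.2).2
  have hmc : Continuous m := by
    rw [Int.isClosedEmbedding_coe_real.isInducing.continuous_iff]
    have h2 : (Int.cast : ℤ → ℝ) ∘ m =
        fun p => (F ((p.1, (p.2 : ℝ)), 1)).2 - ((g.1 (p.1, p.2)).2 : ℝ) := by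
      ext p
      simp [hm p]
    rw [h2]
    have h3 : Continuous fun p : M × unitInterval => F ((p.1, (p.2 : ℝ)), 1) :=
      hF.contMDiff.continuous.comp (by fun_prop)
    have h4 : Continuous fun p : M × unitInterval => g.1 p := g.1.contMDiff.continuous
    exact (continuous_snd.comp h3).sub (continuous_subtype_val.comp (continuous_snd.comp h4))
  have hconst (x : M) (s : unitInterval) : m (x, s) = m (x, 0) :=
    PreconnectedSpace.constant inferInstance
      (f := fun s : unitInterval => m (x, s)) (hmc.comp (by fun_prop))
  set κ : M → ℝ := fun x => m (x, 0) with hκdef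
  have hκ : ContMDiff (𝓡 n) 𝓘(ℝ, ℝ) ∞ κ := fun x => by
    have h2 : Continuous fun x : M => m (x, 0) := hmc.comp (by fun_prop)
    refine (contMDiffAt_const (c := κ x)).congr_of_eventuallyEq ?_
    filter_upwards [h2.continuousAt.eventually (mem_nhds_discrete.2 (Set.mem_singleton _))]
      with y hy
    simp only [hκdef]
    exact congrArg _ hy
  refine ⟨_, _, hF.comp_translate hκ, fun x s => ?_⟩
  have h2 := hF.apply_add_int x s 1 (-m (x, 0))
  simp only [Real.smoothTransition.one, one_mul, hκdef]
  push_cast at h2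
  rw [sub_eq_add_neg, h2, hm (x, s), hconst, (hFg' x s).1]
  simp

end Lifting

/-! ### From M × ℝ back to M × [0, 1] -/

section Cylinder

/-- The retraction of `M × ℝ` onto `M × [0, 1]`. -/
def clamp {X : Type*} (p : X × ℝ) : X × unitInterval := (p.1, Set.projIcc 0 1 zero_le_one p.2)

/-- The inclusion of `M × [0, 1]` into `M × ℝ`. -/
def unclamp {X : Type*} (p : X × unitInterval) : X × ℝ := (p.1, p.2)

@[simp] theorem clamp_unclamp {X : Type*} (p : X × unitInterval) : clamp (unclamp p) = p := by
  simp [clamp, unclamp]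

theorem unclamp_clamp {X : Type*} {p : X × ℝ} (hp : p.2 ∈ Set.Icc 0 1) : unclamp (clamp p) = p := by
  simp [clamp, unclamp, Set.projIcc_of_mem _ hp]

variable {n : ℕ} {M : Type*} [TopologicalSpace M] [ChartedSpace (EuclideanSpace ℝ (Fin n)) M]

theorem contMDiff_unclamp : ContMDiff ((𝓡 n).prod (𝓡∂ 1)) ((𝓡 n).prod 𝓘(ℝ, ℝ)) ∞
    (unclamp (X := M)) :=
  contMDiff_fst.prodMk (contMDiff_subtypeVal_Icc.comp contMDiff_snd)

/-- The retraction is not smooth on M × ℝ, but on maps with values in M × [0, 1] it only restricts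
the codomain. -/
theorem contMDiff_clamp_comp {E : Type*} [NormedAddCommGroup E] [NormedSpace ℝ E]
    {H : Type*} [TopologicalSpace H] {I : ModelWithCorners ℝ E H}
    {X : Type*} [TopologicalSpace X] [ChartedSpace H X] {f : X → M × ℝ}
    (hf : ContMDiff I ((𝓡 n).prod 𝓘(ℝ, ℝ)) ∞ f) (h : ∀ x, (f x).2 ∈ Set.Icc (0 : ℝ) 1) :
    ContMDiff I ((𝓡 n).prod (𝓡∂ 1)) ∞ (fun x => clamp (f x)) := by
  refine (contMDiff_fst.comp hf).prodMk (contMDiff_iff_comp_subtypeVal_Icc.2 ⟨?_, ?_⟩)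
  · exact continuous_projIcc.comp (continuous_snd.comp hf.continuous)
  · refine (contMDiff_snd.comp hf).congr fun x => ?_
    simp [Set.projIcc_of_mem _ (h x)]

/-- By compactness of M, the tube lemma gives a collar of uniform width. -/
theorem exists_collar [CompactSpace M] {V : Set (M × unitInterval)}
    (hV : V ∈ 𝓝ˢ (((𝓡 n).prod (𝓡∂ 1)).boundary (M × unitInterval))) :
    ∃ ε : ℝ, 0 < ε ∧ ε ≤ 1 / 2 ∧ ∀ (x : M) (s : unitInterval),
      (s : ℝ) ∉ Set.Ioo ε (1 - ε) → (x, s) ∈ V := by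
  rw [boundary_cylinder, isCompact_univ.nhdsSet_prod_eq (Set.toFinite _).isCompact,
    nhdsSet_univ, Filter.mem_prod_iff] at hV
  obtain ⟨t₁, h1, t₂, h2, hV⟩ := hV
  rw [Filter.mem_top] at h1
  rw [nhdsSet_insert, nhdsSet_singleton, Filter.mem_sup, Metric.mem_nhds_iff,
    Metric.mem_nhds_iff] at h2
  obtain ⟨⟨a, ha, ha'⟩, ⟨b, hb, hb'⟩⟩ := h2
  refine ⟨min (1 / 2) (min (a / 2) (b / 2)), by positivity, min_le_left _ _, fun x s hs => ?_⟩
  refine hV ⟨h1 ▸ trivial, ?_⟩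
  set ε := min (1 / 2) (min (a / 2) (b / 2))
  have h3 : ε ≤ a / 2 := (min_le_right _ _).trans (min_le_left _ _)
  have h4 : ε ≤ b / 2 := (min_le_right _ _).trans (min_le_right _ _)
  rw [Set.mem_Ioo, not_and_or, not_lt, not_lt] at hs
  rcases hs with hs | hs
  · apply ha'
    rw [Metric.mem_ball, Subtype.dist_eq, Real.dist_eq]
    simp only [Set.Icc.coe_zero, sub_zero]
    rw [abs_of_nonneg s.2.1]
    linarith
  · apply hb'
    rw [Metric.mem_ball, Subtype.dist_eq, Real.dist_eq]
    simp only [Set.Icc.coe_one]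
    rw [abs_of_nonpos (by linarith [s.2.2])]
    linarith

theorem nhdsSet_boundary_of_collar {ε : ℝ} (hε : 0 < ε) :
    ∀ᶠ p : M × unitInterval in 𝓝ˢ (((𝓡 n).prod (𝓡∂ 1)).boundary (M × unitInterval)),
      (p.2 : ℝ) ∉ Set.Icc ε (1 - ε) := by
  have ho : IsOpen {p : M × unitInterval | (p.2 : ℝ) ∉ Set.Icc ε (1 - ε)} :=
    (isClosed_Icc.preimage (by fun_prop : Continuous fun p : M × unitInterval =>
      (p.2 : ℝ))).isOpen_compl
  refine ho.mem_nhdsSet.2 fun p hp => ?_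
  rw [boundary_cylinder] at hp
  rcases hp.2 with h | h
  · simp only [Set.mem_ofPred_eq, h, Set.mem_Icc, Set.Icc.coe_zero]
    intro h2
    linarith [h2.1]
  · rw [Set.mem_singleton_iff] at h
    simp only [Set.mem_ofPred_eq, h, Set.mem_Icc, Set.Icc.coe_one]
    intro h2
    linarith [h2.2]

/-- A family of diffeomorphisms of `M × ℝ` supported in the interior of `M × [0, 1]` restricts to
an isotopy of `M × [0, 1]` rel boundary. -/
theorem IsDiffFamily.exists_isIsotopyRel {Q R : ℝ × (M × ℝ) → M × ℝ} (h : IsDiffFamily n Q R)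
    {ε : ℝ} (hε : 0 < ε) (hQ : ∀ r p, p.2 ∉ Set.Icc ε (1 - ε) → Q (r, p) = p) :
    ∃ k : unitInterval → diffRel ((𝓡 n).prod (𝓡∂ 1)) (M × unitInterval), IsIsotopyRel k ∧
      ∀ t p, (k t).1 p = clamp (Q (t, unclamp p)) := by
  have hR (r p) (hp : p.2 ∉ Set.Icc ε (1 - ε)) : R (r, p) = p := h.apply_inv_of_apply (hQ r p hp)
  -- Stated for an arbitrary family, so that it also applies to the inverses. A point sent outside M
  -- × [0, 1] would land where the map is the identity, hence would already lie outside.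
  have key {Q R : ℝ × (M × ℝ) → M × ℝ} (h : IsDiffFamily n Q R)
      (hQ : ∀ r p, p.2 ∉ Set.Icc ε (1 - ε) → Q (r, p) = p) (r : ℝ) (p : M × unitInterval) :
      (Q (r, unclamp p)).2 ∈ Set.Icc (0 : ℝ) 1 := by
    by_contra h1
    have h2 : (Q (r, unclamp p)).2 ∉ Set.Icc ε (1 - ε) := fun h2 =>
      h1 ⟨by linarith [h2.1], by linarith [h2.2]⟩
    have h3 := congrArg (fun q => R (r, q)) (hQ r _ h2)
    simp only [h.left_inv] at h3
    rw [h3] at h1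
    exact h1 p.2.2
  have hsm {Q R : ℝ × (M × ℝ) → M × ℝ} (h : IsDiffFamily n Q R)
      (hQ : ∀ r p, p.2 ∉ Set.Icc ε (1 - ε) → Q (r, p) = p) :
      ContMDiff ((𝓡∂ 1).prod ((𝓡 n).prod (𝓡∂ 1))) ((𝓡 n).prod (𝓡∂ 1)) ∞
        (fun p : unitInterval × (M × unitInterval) => clamp (Q (p.1, unclamp p.2))) :=
    contMDiff_clamp_comp (h.contMDiff.comp ((contMDiff_subtypeVal_Icc.comp contMDiff_fst).prodMk
      (contMDiff_unclamp.comp contMDiff_snd))) fun p => key h hQ _ _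
  let d (t : unitInterval) : Diff ((𝓡 n).prod (𝓡∂ 1)) (M × unitInterval) :=
    { toFun := fun p => clamp (Q (t, unclamp p))
      invFun := fun p => clamp (R (t, unclamp p))
      left_inv := fun p => by
        beta_reduce
        rw [unclamp_clamp (key h hQ _ _), h.left_inv, clamp_unclamp]
      right_inv := fun p => by
        beta_reduce
        rw [unclamp_clamp (key h.symm hR _ _), h.right_inv, clamp_unclamp]
      contMDiff_toFun := (hsm h hQ).comp ((contMDiff_const (c := t)).prodMk contMDiff_id)
      contMDiff_invFun := (hsm h.symm hR).comp ((contMDiff_const (c := t)).prodMk contMDiff_id) }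
  have hd : ∀ᶠ p in 𝓝ˢ (((𝓡 n).prod (𝓡∂ 1)).boundary (M × unitInterval)), ∀ t, d t p = p := by
    filter_upwards [nhdsSet_boundary_of_collar (n := n) (M := M) hε] with p hp t
    change clamp (Q (t, unclamp p)) = p
    rw [hQ _ _ hp, clamp_unclamp]
  exact ⟨fun t => ⟨d t, hd.mono fun p hp => hp t⟩, ⟨⟨hsm h hQ, hsm h.symm hR⟩, hd⟩,
    fun _ _ => rfl⟩

theorem isotopicRel_one_of_isotopic_closeUp [CompactSpace M] [IsManifold (𝓡 n) ∞ M]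
    (g : diffRel ((𝓡 n).prod (𝓡∂ 1)) (M × unitInterval)) (hg : Isotopic (closeUp g) 1) :
    IsotopicRel g 1 := by
  obtain ⟨ε, hε, hε', hgε⟩ := exists_collar g.2
  obtain ⟨F, K, hF, hFg⟩ := exists_periodicIsotopy g hg
  have hF1 (x : M) (s : ℝ) (hs : s ∈ Set.Icc 0 1) (hs' : s ∉ Set.Ioo ε (1 - ε)) :
      F ((x, s), 1) = (x, s) := by
    have h1 : g.1 (x, ⟨s, hs⟩) = (x, ⟨s, hs⟩) := hgε x ⟨s, hs⟩ hs'
    have h2 := hFg x ⟨s, hs⟩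
    rwa [h1] at h2
  obtain ⟨Q, R, hQ, hQ0, hQε, hQ1⟩ := hF.exists_compact_Icc hε hε'
    (fun x s hs => hF1 x s ⟨hs.1, by linarith [hs.2]⟩ fun h => not_lt.2 hs.2 h.1)
    (fun x s hs => hF1 x s ⟨by linarith [hs.1], hs.2⟩ fun h => not_lt.2 hs.1 h.2)
  obtain ⟨k, hk, hkQ⟩ := hQ.exists_isIsotopyRel (half_pos hε) hQε
  -- Isotopy rel boundary is symmetric because it is equality of classes; the isotopy at hand runs
  -- from 1 to g.
  rw [← mk_eq_mk_rel_iff, eq_comm, mk_eq_mk_rel_iff]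
  refine ⟨k, hk, Subtype.ext (Diffeomorph.ext fun p => ?_),
    Subtype.ext (Diffeomorph.ext fun p => ?_)⟩
  · rw [hkQ, Set.Icc.coe_zero, hQ0, clamp_unclamp]
    rfl
  · rw [hkQ, Set.Icc.coe_one, hQ1 _ p.2.2]
    have := hFg p.1 p.2
    exact (congrArg clamp this).trans (clamp_unclamp (g.1 p))

theorem piZeroCloseUp_injective [CompactSpace M] [IsManifold (𝓡 n) ∞ M] :
    Function.Injective (piZeroCloseUp n M) := by
  rw [injective_iff_map_eq_one]
  intro a ha
  obtain ⟨g, rfl⟩ := QuotientGroup.mk_surjective a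
  exact (mk_eq_mk_rel_iff g 1).2
    (isotopicRel_one_of_isotopic_closeUp g ((mk_eq_mk_iff (closeUp g) 1).1 ha))

end Cylinder

end ClosingClam

end

theorem mainTheorem5 (n : ℕ) (M : Type*) [TopologicalSpace M] [T2Space M] [CompactSpace M]
    [ChartedSpace (EuclideanSpace ℝ (Fin n)) M] [IsManifold (𝓡 n) ∞ M] :
    Function.Injective (ClosingClam.piZeroCloseUp n M) ∧
      ∀ g : ClosingClam.diffRel ((𝓡 n).prod (𝓡∂ 1)) (M × unitInterval),
        ClosingClam.Isotopic (ClosingClam.closeUp g) 1 → ClosingClam.IsotopicRel g 1 :=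
  ⟨ClosingClam.piZeroCloseUp_injective,
    fun g hg => ClosingClam.isotopicRel_one_of_isotopic_closeUp g hg⟩
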